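/- Let $\Sigma$ be a fixed finite set of labels and let $\star\notin\Sigma$ be a wildcard symbol. A \emph{tree pattern} is a tuple $p=(N_p,\mathrm{root}_p,\mathrm{lab}_p,\mathrm{child}_p,\mathrm{desc}_p)$ with a finite set $N_p$ of nodes, a root $\mathrm{root}_p\in N_p$, a labeling $\mathrm{lab}_p:N_p\to\Sigma\cup\{\star\}$ and disjoint sets $\mathrm{child}_p,\mathrm{desc}_p\subseteq N_p\times N_p$ of child edges and descendant edges such that $\mathrm{child}_p\cup\mathrm{desc}_p$ is acyclic and every non-root node has exactly one predecessor in it. The degree $\deg_p(n)$ of a node $n$ is the number of nodes $n'$ with $(n,n')\in\mathrm{child}_p\cup\mathrm{desc}_p$. A \emph{tree} is a tree pattern with $\mathrm{desc}_t=\emptyset$ and without the label $\star$. Write $R^+$ and $R^*$ for the transitive and the reflexive transitive closure of a relation $R$. An \emph{ancestor-preserving embedding} of a tree pattern $p$ in a tree $t$ is a function $h:N_p\to N_t$ such that (1) $h(\mathrm{root}_p)=\mathrm{root}_t$; (2) $(h(n),h(n'))\in\mathrm{child}_t$ for every $(n,n')\in\mathrm{child}_p$; (3) $(h(n),h(n'))\in\mathrm{child}_t^+$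 for every $(n,n')\in\mathrm{desc}_p$; (4) $\mathrm{lab}_t(h(n))=\mathrm{lab}_p(n)$ for every $n\in N_p$ with $\mathrm{lab}_p(n)\neq\star$; (5) for all $n_1,n_2\in N_p$: $(h(n_1),h(n_2))\in\mathrm{child}_t^*$ if and only if $(n_1,n_2)\in(\mathrm{child}_p\cup\mathrm{desc}_p)^*$. \textbf{Theorem.} For every fixed $k\ge 0$, the problem $$\mathcal{M}_{\mathrm{anc}}^{\mathrm{D}\le k}=\{(t,p)\mid t\text{ is a tree},\ p\text{ is a tree pattern with }\deg_p(n)\le k\text{ for all }n\in N_p,\text{ and there is an ancestor-preserving embedding of }p\text{ in }t\}$$ is in P. Here the nodes of $t$ and of $p$ are named by initial segments of $\mathbb{N}$, and each of $t$ and $p$ is given by its root, its node labels and the adjacency matrix of its edges. -/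

import Mathlib

/-- A tree pattern with set of nodes `N` over the set of labels `S`. The label `none` is the
wildcard symbol, which is not in `S`. The edges point from a node to its children. -/
structure TreePattern (S N : Type) where
  finite : Finite N
  root : N
  lab : N → Option S
  child : N → N → Prop
  desc : N → N → Prop
  disjoint : ∀ a b, ¬ (child a b ∧ desc a b)
  acyclic : ∀ a, ¬ Relation.TransGen (fun x y => child x y ∨ desc x y) a a
  existsUnique_pred : ∀ b, b ≠ root → ∃! a, child a b ∨ desc a b

namespace TreePattern

/-- `b` is a child of `a`, through an edge of either kind. -/
def Edge {S N : Type} (p : TreePattern S N) (a b : N) : Prop :=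
  p.child a b ∨ p.desc a b

/-- `a` is an ancestor of `b`; this relation is reflexive. -/
def Ancestor {S N : Type} (p : TreePattern S N) : N → N → Prop :=
  Relation.ReflTransGen p.Edge

/-- The degree of a node is the number of its children. -/
noncomputable def degree {S N : Type} (p : TreePattern S N) (a : N) : ℕ :=
  {b : N | p.Edge a b}.ncard

/-- A tree is a tree pattern without descendant edges and without wildcards. -/
def IsTree {S N : Type} (t : TreePattern S N) : Prop :=
  (∀ a b, ¬ t.desc a b) ∧ ∀ a, t.lab a ≠ none

/-- `h` is a (standard) embedding of the tree pattern `p` in the tree `t`. -/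
structure IsEmbedding {S M N : Type} (t : TreePattern S N) (p : TreePattern S M)
    (h : M → N) : Prop where
  map_root : h p.root = t.root
  map_child : ∀ a b, p.child a b → t.child (h a) (h b)
  map_desc : ∀ a b, p.desc a b → Relation.TransGen t.child (h a) (h b)
  map_lab : ∀ a, p.lab a ≠ none → t.lab (h a) = p.lab a

/-- `h` is an ancestor-preserving embedding of the tree pattern `p` in the tree `t`. -/
structure IsAncEmbedding {S M N : Type} (t : TreePattern S N) (p : TreePattern S M)
    (h : M → N) : Prop extends IsEmbedding t p h where
  ancestor_iff : ∀ a b, Relation.ReflTransGen t.child (h a) (h b) ↔ p.Ancestor a b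

/-- There is an ancestor-preserving embedding of `p` in `t`. -/
def AncEmbeds {S M N : Type} (t : TreePattern S N) (p : TreePattern S M) : Prop :=
  ∃ h : M → N, IsAncEmbedding t p h

/-- The alphabet in which pairs of a tree and a tree pattern are written down. -/
inductive Letter (S : Type) : Type
  | node (isRoot : Bool) (label : Option S)
  | noEdge
  | childEdge
  | descEdge
  | separator

open Classical in
/-- The entry `(a, b)` of the adjacency matrix of `p`. -/
noncomputable def entry {S N : Type} (p : TreePattern S N) (a b : N) : Letter S :=
  if p.child a b then Letter.childEdge
  else if p.desc a b then Letter.descEdge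
  else Letter.noEdge

/-- A pattern with nodes `0, …, n - 1` is written node by node: first a letter with the label of
the node, marked if the node is the root, then the node's row of the adjacency matrix. -/
noncomputable def encode {S : Type} {n : ℕ} (p : TreePattern S (Fin n)) : List (Letter S) :=
  (List.finRange n).flatMap fun a =>
    Letter.node (decide (a = p.root)) (p.lab a) :: (List.finRange n).map (p.entry a)

/-- The word for the pair `(t, p)`. -/
noncomputable def encodePair {S : Type} {n m : ℕ} (t : TreePattern S (Fin n))
    (p : TreePattern S (Fin m)) : List (Letter S) :=
  t.encode ++ Letter.separator :: p.encode

/-- The language of (the words for) the pairs `(t, p)` of a tree `t` and a tree pattern `p` with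
all degrees at most `k` such that there is an ancestor-preserving embedding of `p` in `t`. -/
def ancLanguage (S : Type) (k : ℕ) : Language (Letter S) :=
  {w | ∃ (n m : ℕ) (t : TreePattern S (Fin n)) (p : TreePattern S (Fin m)),
    t.IsTree ∧ AncEmbeds t p ∧ (∀ a, p.degree a ≤ k) ∧ w = encodePair t p}

end TreePattern

open Classical in
/-- The complexity class P: the language `L` is decided by a deterministic multi-stack Turing
machine that halts on every word, whether in `L` or not, within a number of steps bounded by a
polynomial in the length of the word. -/
def InP {A : Type} (L : Language A) : Prop :=
  Nonempty (Turing.TM2ComputableInPolyTime (id : List A → List A) Computability.encodeBool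
    (fun w => decide (w ∈ L)))

/-!
Ancestor-preserving embeddings can be found by dynamic programming. The subpattern at a node `u`
embeds at a node `v` of the tree if and only if the labels fit and the subpatterns at the children
of `u` embed at pairwise incomparable descendants of `v` (`TreePattern.subEmbeds_iff`). Since
incomparable nodes have disjoint subtrees, the embeddings at the children can be chosen
independently of each other once their roots are fixed. If `u` has at most `k` children, there are
at most `n ^ k` choices for these roots in a tree with `n` nodes, which is polynomial as `k` is
fixed. A table of the pairs `(u, v)` is improved repeatedly; after `j` rounds it is correct for all
`u` whose subtree has at most `j` nodes (`TreePattern.getElem?_embedTable`).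

That this can be done by a Turing machine in polynomial time is proved in two layers. The lower
layer consists of structured stack programs with a big-step semantics (`StackProg.Run`) and their
translation to multi-stack Turing machines, which simulate them without loss of time
(`StackProg.steps_of_run`). The upper layer is a class `PolyTime` of functions between types whose
elements are stored on a fixed number of stacks. Numbers are stored in unary, and propositions are
values as well, so that predicates are special functions. The class is closed under composition,
pairing, case distinction, and iteration with polynomially bounded intermediate results
(`PolyTime.iterate`); from this follow arithmetic, bounded quantifiers, and the tabulation of
predicates. The algorithm is then simply a predicate on words, `TreePattern.Accepts`, that is
written with these means: tuples of `k` nodes are coded as the digits of one number, and ancestors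
are found by iterating the function that sends a node to its parent.
-/

/-! ### Stack programs and their translation to Turing machines -/

/-- Structured programs that work on stacks numbered by `ℕ`, with stack alphabet `Γ`. -/
inductive StackProg (Γ : Type) : Type
  | skip : StackProg Γ
  /-- Push the symbol `c` on the stack `i`. -/
  | push (i : ℕ) (c : Γ) : StackProg Γ
  | seq (p q : StackProg Γ) : StackProg Γ
  /-- Pop the stack `i` and continue with the program for what was popped. -/
  | popCases (i : ℕ) (f : Option Γ → StackProg Γ) : StackProg Γ
  /-- Pop symbols `c` from the stack `i` and run `f c`, until the stack is found empty. -/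
  | loop (i : ℕ) (f : Γ → StackProg Γ) : StackProg Γ

namespace StackProg

open Function Turing StateTransition

variable {Γ A : Type}

/-- `Run p s s' t`: the program `p` leads from the memory `s` to the memory `s'` in time `t`. The
time counts the steps of the Turing machine for `p`, so even `skip` takes a step. -/
inductive Run : StackProg Γ → (ℕ → List Γ) → (ℕ → List Γ) → ℕ → Prop
  | skip (s : ℕ → List Γ) : Run skip s s 1
  | push (i : ℕ) (c : Γ) (s : ℕ → List Γ) : Run (push i c) s (update s i (c :: s i)) 1
  | seq {p q : StackProg Γ} {s s' s'' : ℕ → List Γ} {t t' : ℕ} :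
      Run p s s' t → Run q s' s'' t' → Run (seq p q) s s'' (t + t')
  | popCases {i : ℕ} {f : Option Γ → StackProg Γ} {s s' : ℕ → List Γ} {t : ℕ} :
      Run (f (s i).head?) (update s i (s i).tail) s' t → Run (popCases i f) s s' (t + 1)
  | loop_nil {i : ℕ} (f : Γ → StackProg Γ) {s : ℕ → List Γ} : s i = [] → Run (loop i f) s s 1
  | loop_cons {i : ℕ} {f : Γ → StackProg Γ} {c : Γ} {l : List Γ} {s s' s'' : ℕ → List Γ}
      {t t' : ℕ} : s i = c :: l → Run (f c) (update s i l) s' t → Run (loop i f) s' s'' t' →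
      Run (loop i f) s s'' (t + t' + 1)

/-- All stacks that occur in the program have numbers at most `N`. -/
def Below (N : ℕ) : StackProg Γ → Prop
  | skip => True
  | push i _ => i ≤ N
  | seq p q => Below N p ∧ Below N q
  | popCases i f => i ≤ N ∧ ∀ c, Below N (f c)
  | loop i f => i ≤ N ∧ ∀ c, Below N (f c)

theorem Below.mono {N N' : ℕ} (h : N ≤ N') : ∀ {p : StackProg Γ}, Below N p → Below N' p
  | skip, _ => trivial
  | push _ _, hp => le_trans hp h
  | seq _ _, hp => ⟨hp.1.mono h, hp.2.mono h⟩
  | popCases _ _, hp => ⟨hp.1.trans h, fun c => (hp.2 c).mono h⟩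
  | loop _ _, hp => ⟨hp.1.trans h, fun c => (hp.2 c).mono h⟩

theorem exists_below [Finite Γ] : ∀ p : StackProg Γ, ∃ N, Below N p := by
  have key : ∀ {ι : Type} [Finite ι] (f : ι → StackProg Γ), (∀ c, ∃ N, Below N (f c)) →
      ∀ i : ℕ, ∃ N, i ≤ N ∧ ∀ c, Below N (f c) := by
    intro ι _ f hf i
    choose N hN using hf
    obtain ⟨M, hM⟩ := (Set.finite_range N).bddAbove
    exact ⟨max i M, le_max_left _ _, fun c =>
      (hN c).mono ((hM (Set.mem_range_self c)).trans (le_max_right _ _))⟩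
  intro p
  induction p with
  | skip => exact ⟨0, trivial⟩
  | push i c => exact ⟨i, le_rfl⟩
  | seq p q hp hq =>
    obtain ⟨N, hN⟩ := hp
    obtain ⟨M, hM⟩ := hq
    exact ⟨max N M, hN.mono (le_max_left _ _), hM.mono (le_max_right _ _)⟩
  | popCases i f ih => exact key f ih i
  | loop i f ih => exact key f ih i

/-- The program points of a program. -/
def Lab : StackProg Γ → Type
  | skip => Unit
  | push _ _ => Unit
  | seq p q => Lab p ⊕ Lab q
  | popCases _ f => Option (Σ c, Lab (f c))
  | loop _ f => Option (Σ c, Lab (f c))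

theorem finite_lab [Finite Γ] : ∀ p : StackProg Γ, Finite (Lab p) := by
  intro p
  induction p with
  | skip => exact inferInstanceAs (Finite Unit)
  | push i c => exact inferInstanceAs (Finite Unit)
  | seq p q hp hq => exact inferInstanceAs (Finite (Lab p ⊕ Lab q))
  | popCases i f ih => exact inferInstanceAs (Finite (Option (Σ c, Lab (f c))))
  | loop i f ih => exact inferInstanceAs (Finite (Option (Σ c, Lab (f c))))

/-- The program point at which a program starts. -/
def entry : (p : StackProg Γ) → Lab p
  | skip => ()
  | push _ _ => ()
  | seq p _ => Sum.inl (entry p)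
  | popCases _ _ => none
  | loop _ _ => none

/-- The stack alphabets of the Turing machine for a program: an input stack, an output stack and
`N + 1` work stacks. -/
def Sym (A : Type) (N : ℕ) : Bool ⊕ Fin (N + 1) → Type
  | .inl true => A
  | .inl false => Bool
  | .inr _ => A ⊕ Bool

/-- The contents of the stacks of the Turing machine, for a memory `s`. -/
def stk {N : ℕ} (l : List A) (o : List Bool) (s : ℕ → List (A ⊕ Bool)) :
    ∀ k, List (Sym A N k)
  | .inl true => l
  | .inl false => o
  | .inr i => s i

theorem update_stk_work {N : ℕ} (l : List A) (o : List Bool) (s : ℕ → List (A ⊕ Bool)) {i : ℕ}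
    (hi : i ≤ N) (x : List (A ⊕ Bool)) :
    update (β := fun k => List (Sym A N k)) (stk (N := N) l o s) (.inr (Fin.ofNat (N + 1) i)) x =
      stk l o (update s i x) := by
  have hval : (Fin.ofNat (N + 1) i).val = i := Nat.mod_eq_of_lt (by omega)
  refine update_eq_iff.2 ⟨?_, ?_⟩
  · exact (congrArg (update s i x) hval).trans (update_self i x s) |>.symm
  · rintro ((_ | _) | k) hk
    · rfl
    · rfl
    · refine (update_of_ne (β := fun _ => List (A ⊕ Bool)) ?_ x s).symm
      intro h
      exact hk (congrArg Sum.inr (Fin.ext (hval.trans h.symm).symm))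

theorem stk_work {N : ℕ} (l : List A) (o : List Bool) (s : ℕ → List (A ⊕ Bool)) {i : ℕ}
    (hi : i ≤ N) : stk (N := N) l o s (.inr (Fin.ofNat (N + 1) i)) = s i := by
  have hval : (Fin.ofNat (N + 1) i).val = i := Nat.mod_eq_of_lt (by omega)
  exact congrArg s hval

theorem stepAux_push_work {Λ : Type} {N : ℕ} (l : List A) (o : List Bool)
    (s : ℕ → List (A ⊕ Bool)) {i : ℕ} (hi : i ≤ N) (f : Option (A ⊕ Bool) → A ⊕ Bool)
    (q : TM2.Stmt (Sym A N) Λ (Option (A ⊕ Bool))) (v : Option (A ⊕ Bool)) :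
    TM2.stepAux (.push (.inr (Fin.ofNat (N + 1) i)) f q) v (stk l o s) =
      TM2.stepAux q v (stk l o (update s i (f v :: s i))) := by
  refine congrArg (TM2.stepAux q v) ((update_stk_work l o s hi _).trans ?_)
  exact congrArg (fun x => stk l o (update s i (f v :: x))) (stk_work l o s hi)

theorem stepAux_pop_work {Λ : Type} {N : ℕ} (l : List A) (o : List Bool)
    (s : ℕ → List (A ⊕ Bool)) {i : ℕ} (hi : i ≤ N)
    (q : TM2.Stmt (Sym A N) Λ (Option (A ⊕ Bool))) (v : Option (A ⊕ Bool)) :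
    TM2.stepAux (.pop (.inr (Fin.ofNat (N + 1) i)) (fun _ c => c) q) v (stk l o s) =
      TM2.stepAux q (s i).head? (stk l o (update s i (s i).tail)) := by
  refine congrArg₂ (TM2.stepAux q) (congrArg List.head? (stk_work l o s hi))
    ((update_stk_work l o s hi _).trans ?_)
  exact congrArg (fun x => stk l o (update s i (List.tail x))) (stk_work l o s hi)

/-- The statements of the Turing machine at the program points of `p`, where `emb` embeds these
into the labels of the machine, and the machine continues at `exit` after `p`. The internal state
holds the symbol that was popped last. -/
def stmt {Λ : Type} (N : ℕ) : (p : StackProg (A ⊕ Bool)) → (Lab p → Λ) → Λ → Lab p →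
    TM2.Stmt (Sym A N) Λ (Option (A ⊕ Bool))
  | skip, _, exit => fun _ => .goto fun _ => exit
  | push i c, _, exit => fun _ =>
      .push (.inr (Fin.ofNat (N + 1) i)) (fun _ => c) (.goto fun _ => exit)
  | seq p q, emb, exit => Sum.elim
      (stmt N p (emb ∘ Sum.inl) (emb (Sum.inr (entry q)))) (stmt N q (emb ∘ Sum.inr) exit)
  | popCases i f, emb, exit => fun l => match l with
    | none => .pop (.inr (Fin.ofNat (N + 1) i)) (fun _ c => c)
        (.goto fun v => emb (some ⟨v, entry (f v)⟩))
    | some ⟨c, l⟩ => stmt N (f c) (fun l => emb (some ⟨c, l⟩)) exit l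
  | loop i f, emb, exit => fun l => match l with
    | none => .pop (.inr (Fin.ofNat (N + 1) i)) (fun _ c => c)
        (.goto fun v => v.elim exit fun c => emb (some ⟨c, entry (f c)⟩))
    | some ⟨c, l⟩ => stmt N (f c) (fun l => emb (some ⟨c, l⟩)) (emb none) l

theorem stmt_popCases {Λ : Type} (N i : ℕ) (f : Option (A ⊕ Bool) → StackProg (A ⊕ Bool))
    (emb : Lab (popCases i f) → Λ) (exit : Λ) :
    stmt N (popCases i f) emb exit (entry (popCases i f)) =
      .pop (.inr (Fin.ofNat (N + 1) i)) (fun _ c => c)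
        (.goto fun v => emb (some ⟨v, entry (f v)⟩)) := by
  rw [entry, stmt]

theorem stmt_loop {Λ : Type} (N i : ℕ) (f : A ⊕ Bool → StackProg (A ⊕ Bool))
    (emb : Lab (loop i f) → Λ) (exit : Λ) :
    stmt N (loop i f) emb exit (entry (loop i f)) =
      .pop (.inr (Fin.ofNat (N + 1) i)) (fun _ c => c)
        (.goto fun v => v.elim exit fun c => emb (some ⟨c, entry (f c)⟩)) := by
  rw [entry, stmt]

/-- The machine `M` gets from the configuration `a` to the configuration `b` in at most `t`
steps. -/
def Steps {K Λ σ : Type} [DecidableEq K] {G : K → Type} (M : Λ → TM2.Stmt G Λ σ)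
    (a b : TM2.Cfg G Λ σ) (t : ℕ) : Prop :=
  Nonempty (EvalsToInTime (TM2.step M) a (some b) t)

section
variable {K Λ σ : Type} [DecidableEq K] {G : K → Type} {M : Λ → TM2.Stmt G Λ σ}
  {a b c : TM2.Cfg G Λ σ} {t t' : ℕ}

theorem Steps.trans (h : Steps M a b t) (h' : Steps M b c t') : Steps M a c (t + t') := by
  obtain ⟨h⟩ := h
  obtain ⟨h'⟩ := h'
  rw [Nat.add_comm]
  exact ⟨h.trans _ _ _ _ _ _ h'⟩

theorem Steps.single {l : Λ} {v : σ} {S : ∀ k, List (G k)} (h : TM2.stepAux (M l) v S = b) :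
    Steps M ⟨some l, v, S⟩ b 1 :=
  ⟨⟨⟨1, by simp [flip, h]⟩, le_rfl⟩⟩

theorem Steps.cons {l : Λ} {v : σ} {S : ∀ k, List (G k)} (h : TM2.stepAux (M l) v S = b)
    (h' : Steps M b c t) : Steps M ⟨some l, v, S⟩ c (t + 1) := by
  rw [Nat.add_comm]
  exact (Steps.single h).trans h'

end

/-- A machine that contains the statements of a program simulates it step by step. -/
theorem steps_of_run {Λ : Type} {N : ℕ} {M : Λ → TM2.Stmt (Sym A N) Λ (Option (A ⊕ Bool))}
    {l : List A} {o : List Bool} {p : StackProg (A ⊕ Bool)} {s s' : ℕ → List (A ⊕ Bool)} {t : ℕ}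
    (h : Run p s s' t) : Below N p → ∀ (emb : Lab p → Λ) (exit : Λ),
      (∀ x, M (emb x) = stmt N p emb exit x) → ∀ v, ∃ v',
        Steps M ⟨some (emb (entry p)), v, stk l o s⟩ ⟨some exit, v', stk l o s'⟩ t := by
  induction h with
  | skip s =>
    intro _ emb exit hM v
    exact ⟨v, Steps.single (by rw [hM]; rfl)⟩
  | push i c s =>
    intro hp emb exit hM v
    refine ⟨v, Steps.single ?_⟩
    rw [hM]
    exact stepAux_push_work l o s hp _ _ v
  | @seq p q s s' s'' t t' h₁ h₂ ih₁ ih₂ =>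
    intro hp emb exit hM v
    obtain ⟨v', h'⟩ := ih₁ hp.1 (emb ∘ Sum.inl) (emb (Sum.inr (entry q)))
      (fun x => hM (Sum.inl x)) v
    obtain ⟨v'', h''⟩ := ih₂ hp.2 (emb ∘ Sum.inr) exit (fun x => hM (Sum.inr x)) v'
    exact ⟨v'', h'.trans h''⟩
  | @popCases i f s s' t h ih =>
    intro hp emb exit hM v
    obtain ⟨v', h'⟩ := ih (hp.2 _) (fun x => emb (some ⟨_, x⟩)) exit
      (fun x => (hM (some ⟨_, x⟩)).trans (by rw [stmt])) (s i).head?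
    refine ⟨v', Steps.cons ?_ h'⟩
    rw [hM, stmt_popCases]
    exact stepAux_pop_work l o s hp.1 _ v
  | @loop_nil i f s hs =>
    intro hp emb exit hM v
    refine ⟨none, Steps.single ?_⟩
    rw [hM, stmt_loop]
    refine (stepAux_pop_work l o s hp.1 _ v).trans ?_
    rw [hs, List.tail_nil, ← hs, update_eq_self, hs]
    rfl
  | @loop_cons i f c x s s' s'' t t' hs h₁ h₂ ih₁ ih₂ =>
    intro hp emb exit hM v
    obtain ⟨v', h'⟩ := ih₁ (hp.2 _) (fun x => emb (some ⟨_, x⟩)) (emb none)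
      (fun x => (hM (some ⟨_, x⟩)).trans (by rw [stmt])) (some c)
    obtain ⟨v'', h''⟩ := ih₂ hp emb exit hM v'
    refine ⟨v'', Steps.cons ?_ (h'.trans h'')⟩
    rw [hM, stmt_loop]
    refine (stepAux_pop_work l o s hp.1 _ v).trans ?_
    rw [hs]
    rfl

/-- The labels of the Turing machine for `p`: `none` for reading the input into the stack `0`,
`some none` for writing the output, and the program points of `p`. -/
abbrev MachineLab (p : StackProg (A ⊕ Bool)) : Type := Option (Option (Lab p))

/-- The statements of the Turing machine for the program `p`, which moves the input to the stack
`0`, runs `p`, and gives out whether the stack `2` is nonempty. -/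
def machineStmt (N : ℕ) (p : StackProg (A ⊕ Bool)) : MachineLab p →
    TM2.Stmt (Sym A N) (MachineLab p) (Option (A ⊕ Bool))
  | none => .pop (.inl true) (fun _ (c : Option A) => c.map Sum.inl)
      (.branch Option.isSome
        (.push (.inr (Fin.ofNat (N + 1) 0)) (fun v => v.getD (Sum.inr true)) (.goto fun _ => none))
        (.goto fun _ => some (some (entry p))))
  | some none => .pop (.inr (Fin.ofNat (N + 1) 2)) (fun _ c => c)
      (.push (.inl false) (fun v => v.isSome) (.load (fun _ => none) .halt))
  | some (some x) => stmt N p (some ∘ some) (some none) x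

/-- The Turing machine for a program. -/
noncomputable def machine [Fintype A] (N : ℕ) (p : StackProg (A ⊕ Bool)) : FinTM2 where
  K := Bool ⊕ Fin (N + 1)
  k₀ := .inl true
  k₁ := .inl false
  Γ := Sym A N
  Λ := MachineLab p
  main := none
  ΛFin := @Fintype.ofFinite _ (@instFiniteOption _ (@instFiniteOption _ (finite_lab p)))
  σ := Option (A ⊕ Bool)
  initialState := none
  Γk₀Fin := inferInstanceAs (Fintype A)
  m := machineStmt N p

theorem update_stk_inp {N : ℕ} (l l' : List A) (o : List Bool) (s : ℕ → List (A ⊕ Bool)) :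
    update (β := fun k => List (Sym A N k)) (stk (N := N) l o s) (.inl true) l' = stk l' o s := by
  refine update_eq_iff.2 ⟨rfl, ?_⟩
  rintro ((_ | _) | k) hk
  · rfl
  · exact absurd rfl hk
  · rfl

theorem update_stk_out {N : ℕ} (l : List A) (o o' : List Bool) (s : ℕ → List (A ⊕ Bool)) :
    update (β := fun k => List (Sym A N k)) (stk (N := N) l o s) (.inl false) o' = stk l o' s := by
  refine update_eq_iff.2 ⟨rfl, ?_⟩
  rintro ((_ | _) | k) hk
  · exact absurd rfl hk
  · rfl
  · rfl

theorem steps_read {N : ℕ} (p : StackProg (A ⊕ Bool)) (w : List A) :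
    ∀ (x : List (A ⊕ Bool)) (v : Option (A ⊕ Bool)),
    Steps (machineStmt N p) ⟨some none, v, stk w [] (update (fun _ => []) 0 x)⟩
      ⟨some (some (some (entry p))), none,
        stk [] [] (update (fun _ => []) 0 ((w.map Sum.inl).reverse ++ x))⟩ (w.length + 1) := by
  induction w with
  | nil =>
    intro x v
    refine Steps.single ?_
    exact congrArg (TM2.Cfg.mk _ _) (update_stk_inp _ _ _ _)
  | cons a w ih =>
    intro x v
    refine Steps.cons (b := ⟨some none, some (Sum.inl a),
      stk w [] (update (fun _ => []) 0 (Sum.inl a :: x))⟩) ?_ ?_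
    · refine (congrArg (TM2.stepAux (.push (.inr (Fin.ofNat (N + 1) 0))
        (fun v => v.getD (Sum.inr true)) (.goto fun _ => none)) (some (Sum.inl a)))
        (update_stk_inp (a :: w) w [] _)).trans ?_
      refine (stepAux_push_work _ _ _ (Nat.zero_le N) _ _ _).trans ?_
      simp
    · simpa using ih (Sum.inl a :: x) (some (Sum.inl a))

/-- A language is in P if a stack program decides it in polynomial time: the program finds the
reversed word on the stack `0` and leaves the answer on the stack `2`, as a stack that is nonempty
if and only if the word is in the language. -/
theorem inP_of_run [Finite A] (L : Language A) (p : StackProg (A ⊕ Bool)) (T : Polynomial ℕ)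
    (h : ∀ w : List A, ∃ (x : List (A ⊕ Bool)) (t : ℕ), t ≤ T.eval w.length ∧ x.tail = [] ∧
      (x ≠ [] ↔ w ∈ L) ∧
      Run p (update (fun _ => []) 0 (w.map Sum.inl).reverse) (update (fun _ => []) 2 x) t) :
    InP L := by
  classical
  have := Fintype.ofFinite A
  obtain ⟨N₀, hN₀⟩ := exists_below p
  set N := max N₀ 2
  have hN : Below N p := hN₀.mono (le_max_left _ _)
  refine ⟨⟨⟨machine N p, Equiv.refl A, Equiv.refl Bool⟩, T + Polynomial.X + 2,
    fun w => Classical.choice ?_⟩⟩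
  obtain ⟨x, t, ht, hx, hxL, hrun⟩ := h w
  have h1 := steps_read (N := N) p w [] none
  rw [List.append_nil] at h1
  obtain ⟨v, h2⟩ := steps_of_run (M := machineStmt N p) (l := []) (o := []) hrun hN
    (some ∘ some) (some none) (fun x => rfl) none
  have h3 : Steps (machineStmt N p) ⟨some (some none), v, stk [] [] (update (fun _ => []) 2 x)⟩
      ⟨none, none, stk [] [decide (w ∈ L)] fun _ => []⟩ 1 := by
    refine Steps.single ?_
    refine (stepAux_pop_work _ _ _ (le_max_right N₀ 2) _ v).trans ?_
    refine (congrArg (TM2.Cfg.mk _ _) (update_stk_out _ _ _ _)).trans ?_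
    have hx' : x.head?.isSome = decide (w ∈ L) := by
      rw [Bool.eq_iff_iff, decide_eq_true_iff, ← hxL]
      cases x <;> simp
    simp only [update_self, update_idem, hx, hx', update_eq_self_iff.2]
    rfl
  obtain ⟨h4⟩ := (h1.trans h2).trans h3
  have hinit : initList (machine N p) w =
      ⟨some none, none, stk w [] (update (fun _ => []) 0 [])⟩ := by
    unfold initList
    congr 1
    funext k
    rcases k with (_ | _) | k
    · rfl
    · rfl
    · simp [stk]; rfl
  have hhalt : haltList (machine N p) [decide (w ∈ L)] =
      ⟨none, none, stk [] [decide (w ∈ L)] fun _ => []⟩ := by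
    unfold haltList
    congr 1
    funext k
    rcases k with (_ | _) | k <;> rfl
  refine ⟨⟨⟨h4.steps, ?_⟩, h4.steps_le_m.trans ?_⟩⟩
  · refine Eq.trans ?_ (h4.evals_in_steps.trans (congrArg some hhalt.symm))
    refine Eq.trans ?_
      (congrArg (fun x => (flip bind (machine N p).step)^[h4.steps] (some x)) hinit)
    exact congrArg (fun x => (flip bind (machine N p).step)^[h4.steps]
      (some (initList (machine N p) x))) (List.map_id w)
  · simp
    omega

end StackProg

/-! ### Basic programs on the memory -/

namespace StackProg

open Function

variable {Γ : Type}

/-- The program `p` leads from the memory `s` to the memory `s'` in time at most `t`. -/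
def Runs (p : StackProg Γ) (s s' : ℕ → List Γ) (t : ℕ) : Prop :=
  ∃ t' ≤ t, Run p s s' t'

theorem Runs.mono {p : StackProg Γ} {s s' : ℕ → List Γ} {t t' : ℕ} (h : Runs p s s' t)
    (ht : t ≤ t') : Runs p s s' t' :=
  let ⟨u, hu, hr⟩ := h
  ⟨u, hu.trans ht, hr⟩

theorem Runs.seq {p q : StackProg Γ} {s s' s'' : ℕ → List Γ} {t t' : ℕ} (h : Runs p s s' t)
    (h' : Runs q s' s'' t') : Runs (seq p q) s s'' (t + t') :=
  let ⟨_, hu, hr⟩ := h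
  let ⟨_, hu', hr'⟩ := h'
  ⟨_, add_le_add hu hu', hr.seq hr'⟩

theorem Runs.popCases {i : ℕ} {f : Option Γ → StackProg Γ} {s s' : ℕ → List Γ} {t : ℕ}
    (h : Runs (f (s i).head?) (update s i (s i).tail) s' t) :
    Runs (popCases i f) s s' (t + 1) :=
  let ⟨_, hu, hr⟩ := h
  ⟨_, Nat.succ_le_succ hu, hr.popCases⟩

theorem Runs.loop_nil {i : ℕ} (f : Γ → StackProg Γ) {s : ℕ → List Γ} (h : s i = []) :
    Runs (loop i f) s s 1 :=
  ⟨1, le_rfl, .loop_nil f h⟩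

theorem Runs.loop_cons {i : ℕ} {f : Γ → StackProg Γ} {c : Γ} {l : List Γ} {s s' s'' : ℕ → List Γ}
    {t t' : ℕ} (h : s i = c :: l) (h₁ : Runs (f c) (update s i l) s' t)
    (h₂ : Runs (loop i f) s' s'' t') : Runs (loop i f) s s'' (t + t' + 1) :=
  let ⟨_, hu, hr⟩ := h₁
  let ⟨_, hu', hr'⟩ := h₂
  ⟨_, Nat.succ_le_succ (add_le_add hu hu'), .loop_cons h hr hr'⟩

theorem runs_skip (s : ℕ → List Γ) : Runs skip s s 1 :=
  ⟨1, le_rfl, .skip s⟩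

theorem runs_push (i : ℕ) (c : Γ) (s : ℕ → List Γ) :
    Runs (push i c) s (update s i (c :: s i)) 1 :=
  ⟨1, le_rfl, .push i c s⟩

/-- Empty the stack `i`. -/
def clear (i : ℕ) : StackProg Γ :=
  loop i fun _ => skip

theorem runs_clear (i : ℕ) (x : List Γ) : ∀ s : ℕ → List Γ, s i = x →
    Runs (clear i) s (update s i []) (2 * x.length + 1) := by
  induction x with
  | nil =>
    intro s hs
    have : update s i [] = s := by rw [← hs, update_eq_self]
    rw [this]
    exact Runs.loop_nil _ hs
  | cons c x ih =>
    intro s hs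
    have := Runs.loop_cons (f := fun _ => skip) hs (runs_skip _) (ih (update s i x) (by simp))
    rw [update_idem] at this
    exact this.mono (by simp; omega)

/-- Move the contents of the stack `i` to the stack `j`, applying `g` to the symbols. This reverses
their order. -/
def moveMap (g : Γ → Γ) (i j : ℕ) : StackProg Γ :=
  loop i fun c => push j (g c)

theorem runs_moveMap (g : Γ → Γ) {i j : ℕ} (hij : i ≠ j) (x : List Γ) : ∀ s : ℕ → List Γ, s i = x →
    Runs (moveMap g i j) s (update (update s i []) j ((x.map g).reverse ++ s j))
      (2 * x.length + 1) := by
  induction x with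
  | nil =>
    intro s hs
    have : update (update s i []) j (([].map g).reverse ++ s j) = s := by
      funext k
      by_cases hj : k = j
      · subst hj; simp
      · by_cases hi : k = i
        · subst hi; simp [hj, hs]
        · simp [hi, hj]
    rw [this]
    exact Runs.loop_nil _ hs
  | cons c x ih =>
    intro s hs
    have := Runs.loop_cons (f := fun c => push j (g c)) hs (runs_push _ _ _)
      (ih _ (by rw [update_of_ne hij, update_self]))
    refine (Eq.subst (motive := fun s' => Runs (moveMap g i j) s s' _) ?_ this).mono
      (by simp; omega)
    funext k
    by_cases hj : k = j
    · subst hj; simp [hij.symm]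
    · by_cases hi : k = i
      · subst hi; simp [hj]
      · simp [hi, hj]

/-- Move the contents of the stack `i` to the top of the stack `j`, by way of the stack `t`. -/
def transfer (i j t : ℕ) : StackProg Γ :=
  seq (moveMap id i t) (moveMap id t j)

theorem runs_transfer {i j t : ℕ} (hij : i ≠ j) (hit : i ≠ t) (hjt : j ≠ t) (s : ℕ → List Γ)
    (ht : s t = []) :
    Runs (transfer i j t) s (update (update s i []) j (s i ++ s j)) (4 * (s i).length + 2) := by
  have h := (runs_moveMap id hit _ s rfl).seq (runs_moveMap id hjt.symm _ _ rfl)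
  refine (Eq.subst (motive := fun s' => Runs (transfer i j t) s s' _) ?_ h).mono
    (by simp [ht]; omega)
  funext k
  by_cases hj : k = j
  · subst hj; simp [hjt, ht, hij.symm]
  · by_cases hi : k = i
    · subst hi; simp [hj, hit]
    · by_cases hk : k = t
      · subst hk; simp [hj, hi, ht]
      · simp [hi, hj, hk]

/-- Copy the contents of the stack `i` to the top of the stack `j`, by way of the stack `t`. -/
def copy (i j t : ℕ) : StackProg Γ :=
  seq (moveMap id i t) (loop t fun c => seq (push i c) (push j c))

theorem runs_copy {i j t : ℕ} (hij : i ≠ j) (hit : i ≠ t) (hjt : j ≠ t) (s : ℕ → List Γ)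
    (ht : s t = []) :
    Runs (copy i j t) s (update s j (s i ++ s j)) (5 * (s i).length + 2) := by
  have key : ∀ (x : List Γ) (s : ℕ → List Γ), s t = x →
      Runs (loop t fun c => seq (push i c) (push j c)) s
        (update (update (update s t []) i (x.reverse ++ s i)) j (x.reverse ++ s j))
        (3 * x.length + 1) := by
    intro x
    induction x with
    | nil =>
      intro s hs
      have : update (update (update s t []) i ([].reverse ++ s i)) j ([].reverse ++ s j) = s := by
        funext k
        by_cases hj : k = j
        · subst hj; simp
        · by_cases hi : k = i
          · subst hi; simp [hj]
          · by_cases hk : k = t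
            · subst hk; simp [hi, hj, hs]
            · simp [hi, hj, hk]
      rw [this]
      exact Runs.loop_nil _ hs
    | cons c x ih =>
      intro s hs
      have := Runs.loop_cons (f := fun c => seq (push i c) (push j c)) hs
        ((runs_push i c _).seq (runs_push j c _))
        (ih _ (by rw [update_of_ne hjt.symm, update_of_ne hit.symm, update_self]))
      refine (Eq.subst (motive := fun s' => Runs _ s s' _) ?_ this).mono (by simp; omega)
      funext k
      by_cases hj : k = j
      · subst hj; simp [hij.symm, hjt]
      · by_cases hi : k = i
        · subst hi; simp [hj, hit]
        · by_cases hk : k = t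
          · subst hk; simp [hj, hi]
          · simp [hi, hj, hk]
  have h := (runs_moveMap id hit _ s rfl).seq (key _ _ rfl)
  refine (Eq.subst (motive := fun s' => Runs (copy i j t) s s' _) ?_ h).mono
    (by simp [ht]; omega)
  funext k
  by_cases hj : k = j
  · subst hj; simp [hjt, ht, hij.symm]
  · by_cases hi : k = i
    · subst hi; simp [hj, hit, ht]
    · by_cases hk : k = t
      · subst hk; simp [hj, hi, ht]
      · simp [hi, hj, hk]

/-- The memory whose first stacks are those in the list, and whose other stacks are empty. -/
def mem (l : List (List Γ)) : ℕ → List Γ :=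
  fun i => l.getD i []

@[simp]
theorem mem_append_nil (l : List (List Γ)) : mem (l ++ [[]]) = mem l := by
  funext i
  simp only [mem, List.getD_eq_getElem?_getD]
  rcases lt_trichotomy i l.length with h | h | h
  · rw [List.getElem?_append_left h]
  · subst h; simp
  · rw [List.getElem?_eq_none (by simp; omega), List.getElem?_eq_none (by omega)]

theorem mem_length (l : List (List Γ)) : mem l l.length = [] := by
  simp [mem]

theorem mem_get (l : List (List Γ)) (x : List Γ) (m : List (List Γ)) :
    mem (l ++ x :: m) l.length = x := by
  simp [mem]

theorem update_mem (l : List (List Γ)) (x y : List Γ) (m : List (List Γ)) :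
    update (mem (l ++ x :: m)) l.length y = mem (l ++ y :: m) := by
  funext i
  by_cases h : i = l.length
  · subst h; simp [mem]
  · rw [update_of_ne h]
    simp only [mem, List.getD_eq_getElem?_getD, List.getElem?_append, List.getElem?_cons]
    split_ifs with h₁ h₂
    · rfl
    · omega
    · rfl

theorem update_mem_length (l : List (List Γ)) (y : List Γ) :
    update (mem l) l.length y = mem (l ++ [y]) := by
  rw [← mem_append_nil l, update_mem]

/-- The number of symbols in a list of stacks. -/
def total (l : List (List Γ)) : ℕ :=
  (l.map List.length).sum

@[simp] theorem total_nil : total ([] : List (List Γ)) = 0 := rfl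

@[simp] theorem total_cons (x : List Γ) (l : List (List Γ)) :
    total (x :: l) = x.length + total l := rfl

@[simp] theorem total_append (l m : List (List Γ)) : total (l ++ m) = total l + total m := by
  simp [total]

/-- Remove the stack `p`, and move the `q` stacks after it one place to the front. -/
def remove : ℕ → ℕ → StackProg Γ
  | p, 0 => clear p
  | p, q + 1 => seq (clear p) (seq (transfer (p + 1) p (p + q + 2)) (remove (p + 1) q))

theorem runs_remove (m : List (List Γ)) : ∀ (l : List (List Γ)) (x : List Γ),
    Runs (remove l.length m.length) (mem (l ++ x :: m)) (mem (l ++ m))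
      (4 * (x.length + total m) + 4 * (m.length + 1)) := by
  induction m with
  | nil =>
    intro l x
    have h := runs_clear l.length _ _ (mem_get l x [])
    rw [update_mem, mem_append_nil] at h
    rw [List.append_nil]
    exact h.mono (by simp; omega)
  | cons y m ih =>
    intro l x
    have h₁ := runs_clear l.length _ _ (mem_get l x (y :: m))
    rw [update_mem] at h₁
    have h₂ := runs_transfer (i := l.length + 1) (j := l.length) (t := l.length + m.length + 2)
      (by omega) (by omega) (by omega) (mem (l ++ [] :: y :: m))
      (List.getD_eq_default _ _ (by simp; omega))
    have e : l ++ [] :: y :: m = (l ++ [[]]) ++ y :: m := by simp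
    have e' : (l ++ [[]]).length = l.length + 1 := by simp
    rw [e, ← e', mem_get, update_mem, e', ← e, List.append_assoc, List.singleton_append,
      mem_get, update_mem, List.append_nil] at h₂
    have h₃ := ih (l ++ [y]) []
    rw [List.append_assoc, List.append_assoc, List.singleton_append, List.singleton_append] at h₃
    have e'' : (l ++ [y]).length = l.length + 1 := by simp
    rw [e''] at h₃
    refine (h₁.seq (h₂.seq h₃)).mono ?_
    simp
    omega

/-- Remove the `w` stacks from the stack `p` on, and move the `q` stacks after them to the
front. -/
def removeBlock (p q : ℕ) : ℕ → StackProg Γ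
  | 0 => skip
  | w + 1 => seq (remove p (w + q)) (removeBlock p q w)

theorem runs_removeBlock (l m b : List (List Γ)) :
    Runs (removeBlock l.length m.length b.length) (mem (l ++ b ++ m)) (mem (l ++ m))
      (b.length * (4 * (total b + total m) + 4 * (b.length + m.length)) + 1) := by
  induction b with
  | nil => simpa [removeBlock] using runs_skip _
  | cons x b ih =>
    have h := runs_remove (b ++ m) l x
    rw [← List.append_assoc, List.length_append] at h
    have h' := h.seq ih
    simp only [List.append_assoc, List.cons_append] at h' ⊢
    refine h'.mono ?_
    have : b.length * (4 * (total b + total m) + 4 * (b.length + m.length)) ≤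
        b.length * (4 * (total (x :: b) + total m) + 4 * ((x :: b).length + m.length)) := by
      gcongr <;> simp
    rw [List.length_cons, add_mul]
    simp only [List.length_cons, total_cons, total_append] at *
    omega

/-- Append copies of the `w` stacks from the stack `p` on to the first `n` stacks. -/
def copyBlock : ℕ → ℕ → ℕ → StackProg Γ
  | _, _, 0 => skip
  | p, n, w + 1 => seq (copy p n (n + 1)) (copyBlock (p + 1) (n + 1) w)

theorem runs_copyBlock (b : List (List Γ)) : ∀ l m : List (List Γ),
    Runs (copyBlock l.length (l ++ b ++ m).length b.length) (mem (l ++ b ++ m))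
      (mem (l ++ b ++ m ++ b)) (5 * total b + 2 * b.length + 1) := by
  induction b with
  | nil => intro l m; simpa [copyBlock] using runs_skip _
  | cons x b ih =>
    intro l m
    have h := runs_copy (i := l.length) (j := (l ++ x :: (b ++ m)).length)
      (t := (l ++ x :: (b ++ m)).length + 1) (by simp) (by simp; omega) (by simp)
      (mem (l ++ x :: (b ++ m))) (by simp [mem])
    rw [mem_get, mem_length, update_mem_length, List.append_nil] at h
    have h' := ih (l ++ [x]) (m ++ [x])
    have e : (l ++ [x] ++ b ++ (m ++ [x])).length = (l ++ x :: (b ++ m)).length + 1 := by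
      simp; omega
    rw [e] at h'
    simp only [List.append_assoc, List.cons_append, List.length_append,
      List.length_singleton, List.nil_append] at h h' ⊢
    exact (h.seq h').mono (by simp; omega)

/-- Push the symbols of a list on the stack `i`. -/
def pushList (i : ℕ) : List Γ → StackProg Γ
  | [] => skip
  | c :: x => seq (pushList i x) (push i c)

theorem runs_pushList (i : ℕ) (x : List Γ) (s : ℕ → List Γ) :
    Runs (pushList i x) s (update s i (x ++ s i)) (x.length + 1) := by
  induction x with
  | nil => simpa [pushList] using runs_skip s
  | cons c x ih =>
    have h := ih.seq (runs_push i c _)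
    rw [update_idem, update_self] at h
    exact h

/-- Write down a list of stacks after the first `n` stacks. -/
def pushBlock : ℕ → List (List Γ) → StackProg Γ
  | _, [] => skip
  | n, x :: b => seq (pushList n x) (pushBlock (n + 1) b)

theorem runs_pushBlock (b : List (List Γ)) : ∀ l : List (List Γ),
    Runs (pushBlock l.length b) (mem l) (mem (l ++ b)) (total b + b.length + 1) := by
  induction b with
  | nil => intro l; simpa [pushBlock] using runs_skip _
  | cons x b ih =>
    intro l
    have h := runs_pushList l.length x (mem l)
    rw [mem_length, List.append_nil, update_mem_length] at h
    have h' := ih (l ++ [x])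
    rw [List.length_append, List.length_singleton] at h'
    have := h.seq h'
    simp only [List.append_assoc, List.singleton_append] at this
    exact this.mono (by simp; omega)

end StackProg

/-! ### Functions computable in polynomial time -/

/-- A way to store the elements of `α` on a fixed number of stacks, with the symbols of the
alphabet `A` and two further ones. -/
class StackEnc (A : Type) (α : Type) where
  /-- The number of stacks. -/
  width : ℕ
  /-- The contents of the stacks. -/
  enc : α → List (List (A ⊕ Bool))
  length_enc : ∀ a, (enc a).length = width

namespace StackEnc

variable (A : Type) {α β γ : Type}

/-- Numbers are stored in unary. -/
instance : StackEnc A ℕ where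
  width := 1
  enc n := [List.replicate n (Sum.inr true)]
  length_enc _ := rfl

open Classical in
/-- A proposition is stored as a stack that is nonempty if and only if the proposition is true. In
this way, decidable predicates are just functions into `Prop`. -/
noncomputable instance : StackEnc A Prop where
  width := 1
  enc P := [if P then [Sum.inr true] else []]
  length_enc _ := rfl

instance : StackEnc A (List A) where
  width := 1
  enc w := [w.map Sum.inl]
  length_enc _ := rfl

instance : StackEnc A (List Bool) where
  width := 1
  enc w := [w.map Sum.inr]
  length_enc _ := rfl

instance [StackEnc A α] [StackEnc A β] : StackEnc A (α × β) where
  width := width A α + width A β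
  enc x := enc x.1 ++ enc x.2
  length_enc x := by simp [length_enc]

/-- The number of symbols in the encoding of an element. -/
def size [StackEnc A α] (a : α) : ℕ :=
  StackProg.total (enc (A := A) a)

@[simp] theorem size_nat (n : ℕ) : size A n = n := by
  simp [size, enc]

@[simp] theorem size_list (l : List Bool) : size A l = l.length := by
  simp [size, enc]

@[simp] theorem size_prod [StackEnc A α] [StackEnc A β] (x : α × β) :
    size A x = size A x.1 + size A x.2 := by
  simp [size, enc]

end StackEnc

open StackEnc StackProg

/-- `T a` is bounded by a polynomial in the size of `a`. -/
def PolyBdd (A : Type) {α : Type} [StackEnc A α] (T : α → ℕ) : Prop :=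
  ∃ P : Polynomial ℕ, ∀ a, T a ≤ P.eval (size A a)

theorem Polynomial.eval_mono_nat (P : Polynomial ℕ) {m n : ℕ} (h : m ≤ n) :
    P.eval m ≤ P.eval n := by
  simp only [Polynomial.eval_eq_sum, Polynomial.sum]
  gcongr

namespace PolyBdd

variable {A α β γ : Type} [StackEnc A α] [StackEnc A β] [StackEnc A γ] {T T' : α → ℕ}

theorem mono (h : PolyBdd A T') (h' : ∀ a, T a ≤ T' a) : PolyBdd A T :=
  let ⟨P, hP⟩ := h
  ⟨P, fun a => (h' a).trans (hP a)⟩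

theorem const (c : ℕ) : PolyBdd A fun _ : α => c :=
  ⟨Polynomial.C c, fun a => by simp⟩

theorem add (h : PolyBdd A T) (h' : PolyBdd A T') : PolyBdd A fun a => T a + T' a :=
  let ⟨P, hP⟩ := h
  let ⟨P', hP'⟩ := h'
  ⟨P + P', fun a => by simpa using add_le_add (hP a) (hP' a)⟩

theorem mul (h : PolyBdd A T) (h' : PolyBdd A T') : PolyBdd A fun a => T a * T' a :=
  let ⟨P, hP⟩ := h
  let ⟨P', hP'⟩ := h'
  ⟨P * P', fun a => by simpa using Nat.mul_le_mul (hP a) (hP' a)⟩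

theorem size : PolyBdd A fun a : α => size A a :=
  ⟨Polynomial.X, fun a => by simp⟩

theorem eval (h : PolyBdd A T) (P : Polynomial ℕ) : PolyBdd A fun a => P.eval (T a) :=
  let ⟨Q, hQ⟩ := h
  ⟨P.comp Q, fun a => by simpa using P.eval_mono_nat (hQ a)⟩

theorem comp {U : β → ℕ} (hU : PolyBdd A U) {f : α → β}
    (hf : PolyBdd A fun a => StackEnc.size A (f a)) : PolyBdd A fun a => U (f a) :=
  let ⟨P, hP⟩ := hU
  (hf.eval P).mono fun a => hP (f a)

end PolyBdd

/-- The function `f` is computable in polynomial time by stack programs: for each position of the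
argument in the memory, there is a program that appends the value of `f` to the memory and leaves
the rest of the memory unchanged. The memory consists of the stacks `l`, those of the argument, and
the stacks `m`. The polynomial may depend on the lengths of `l` and `m`, but not on their
contents. -/
@[fun_prop]
structure PolyTime (A : Type) {α β : Type} [StackEnc A α] [StackEnc A β] (f : α → β) :
    Prop where
  size_bdd : PolyBdd A fun a => size A (f a)
  exists_prog : ∀ i j : ℕ, ∃ (p : StackProg (A ⊕ Bool)) (T : α → ℕ), PolyBdd A T ∧
    ∀ (l m : List (List (A ⊕ Bool))) (a : α), l.length = i → m.length = j →
      Runs p (mem (l ++ enc a ++ m)) (mem (l ++ enc a ++ m ++ enc (f a))) (T a)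

namespace PolyTime

variable {A α β γ : Type} [StackEnc A α] [StackEnc A β] [StackEnc A γ]

@[fun_prop]
theorem id : PolyTime A fun a : α => a where
  size_bdd := .size
  exists_prog i j := by
    refine ⟨copyBlock i (i + width A α + j) (width A α), fun a => 5 * size A a + 2 * width A α + 1,
      (((PolyBdd.const 5).mul .size).add (.const _)).add (.const _), ?_⟩
    rintro l m a rfl rfl
    have h := runs_copyBlock (enc (A := A) a) l m
    simp only [List.length_append, length_enc] at h
    exact h

@[fun_prop]
theorem const (b : β) : PolyTime A fun _ : α => b where
  size_bdd := .const _
  exists_prog i j := by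
    refine ⟨pushBlock (i + width A α + j) (enc b),
      fun _ => total (enc (A := A) b) + width A β + 1, .const _, ?_⟩
    rintro l m a rfl rfl
    have h := runs_pushBlock (enc (A := A) b) (l ++ enc a ++ m)
    simp only [List.length_append, length_enc] at h
    exact h

@[fun_prop]
theorem comp {f : β → γ} {g : α → β} (hf : PolyTime A f) (hg : PolyTime A g) :
    PolyTime A fun a => f (g a) where
  size_bdd := hf.size_bdd.comp hg.size_bdd
  exists_prog i j := by
    obtain ⟨p, T, hT, hp⟩ := hg.exists_prog i j
    obtain ⟨q, U, hU, hq⟩ := hf.exists_prog (i + width A α + j) 0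
    refine ⟨seq p (seq q (removeBlock (i + width A α + j) (width A γ) (width A β))),
      fun a => T a + (U (g a) + (width A β * (4 * (size A (g a) + size A (f (g a))) +
        4 * (width A β + width A γ)) + 1)),
      hT.add ((hU.comp hg.size_bdd).add ?_), ?_⟩
    · exact ((PolyBdd.const _).mul (((PolyBdd.const _).mul (hg.size_bdd.add
        (hf.size_bdd.comp hg.size_bdd))).add (.const _))).add (.const _)
    · intro l m a hl hm
      have hlen : (l ++ enc a ++ m).length = i + width A α + j := by
        rw [List.length_append, List.length_append, length_enc, hl, hm]
      have h₂ := hq (l ++ enc a ++ m) [] (g a) hlen rfl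
      simp only [List.append_nil] at h₂
      have h₃ := runs_removeBlock (l ++ enc a ++ m) (enc (A := A) (f (g a))) (enc (A := A) (g a))
      rw [hlen, length_enc, length_enc] at h₃
      exact (hp l m a hl hm).seq (h₂.seq h₃)

@[fun_prop]
theorem prodMk {f : α → β} {g : α → γ} (hf : PolyTime A f) (hg : PolyTime A g) :
    PolyTime A fun a => (f a, g a) where
  size_bdd := by simpa using hf.size_bdd.add hg.size_bdd
  exists_prog i j := by
    obtain ⟨p, T, hT, hp⟩ := hf.exists_prog i j
    obtain ⟨q, U, hU, hq⟩ := hg.exists_prog i (j + width A β)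
    refine ⟨seq p q, _, hT.add hU, ?_⟩
    intro l m a hl hm
    have h := hq l (m ++ enc (f a)) a hl (by simp [hm, length_enc])
    simp only [← List.append_assoc] at h
    simpa [enc] using (hp l m a hl hm).seq h

theorem fst' : PolyTime A (Prod.fst : α × β → α) where
  size_bdd := PolyBdd.size.mono fun a => by simp
  exists_prog i j := by
    refine ⟨copyBlock i (i + width A α + (width A β + j)) (width A α),
      fun a => 5 * size A a.1 + 2 * width A α + 1,
      (((PolyBdd.const 5).mul (PolyBdd.size.mono fun a => by simp)).add (.const _)).add
        (.const _), ?_⟩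
    rintro l m a rfl rfl
    have h := runs_copyBlock (enc (A := A) a.1) l (enc a.2 ++ m)
    simp only [List.length_append, length_enc] at h
    simpa [enc, size] using h

theorem snd' : PolyTime A (Prod.snd : α × β → β) where
  size_bdd := PolyBdd.size.mono fun a => by simp
  exists_prog i j := by
    refine ⟨copyBlock (i + width A α) (i + width A α + width A β + j) (width A β),
      fun a => 5 * size A a.2 + 2 * width A β + 1,
      (((PolyBdd.const 5).mul (PolyBdd.size.mono fun a => by simp)).add (.const _)).add
        (.const _), ?_⟩
    rintro l m a rfl rfl
    have h := runs_copyBlock (enc (A := A) a.2) (l ++ enc a.1) m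
    simp only [List.length_append, length_enc] at h
    simpa [enc, size] using h

@[fun_prop]
theorem fst {f : α → β × γ} (hf : PolyTime A f) : PolyTime A fun a => (f a).1 :=
  fst'.comp hf

@[fun_prop]
theorem snd {f : α → β × γ} (hf : PolyTime A f) : PolyTime A fun a => (f a).2 :=
  snd'.comp hf

open Classical in
@[fun_prop]
theorem ite {c : α → Prop} [DecidablePred c] {f g : α → β} (hc : PolyTime A c)
    (hf : PolyTime A f) (hg : PolyTime A g) : PolyTime A fun a => if c a then f a else g a where
  size_bdd := (hf.size_bdd.add hg.size_bdd).mono fun a => by split_ifs <;> simp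
  exists_prog i j := by
    obtain ⟨r, V, hV, hr⟩ := hc.exists_prog i j
    obtain ⟨p, T, hT, hp⟩ := hf.exists_prog i j
    obtain ⟨q, U, hU, hq⟩ := hg.exists_prog i j
    refine ⟨seq r (popCases (i + width A α + j) fun o => o.elim q fun _ => p), _,
      hV.add ((hT.add hU).add (.const 1)), ?_⟩
    intro l m a hl hm
    have hlen : (l ++ enc a ++ m).length = i + width A α + j := by
        rw [List.length_append, List.length_append, length_enc, hl, hm]
    refine (hr l m a hl hm).seq (Runs.popCases ?_)
    simp only [enc]
    rw [← hlen, mem_get, update_mem]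
    by_cases h : c a
    · simp only [h, if_true, List.head?_cons, Option.elim_some, List.tail_cons, mem_append_nil]
      exact (hp l m a hl hm).mono (Nat.le_add_right _ _)
    · simp only [h, if_false, List.head?_nil, Option.elim_none, List.tail_nil, mem_append_nil]
      exact (hq l m a hl hm).mono (Nat.le_add_left _ _)

/-- Functions can be iterated in polynomial time, if the intermediate results remain small. -/
theorem iterate {n : α → ℕ} {g : α → β} {h : α → β → β} (hn : PolyTime A n) (hg : PolyTime A g)
    (hh : PolyTime A fun x : α × β => h x.1 x.2) {B : α → ℕ} (hB : PolyBdd A B)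
    (hle : ∀ a, ∀ i ≤ n a, size A ((h a)^[i] (g a)) ≤ B a) :
    PolyTime A fun a => (h a)^[n a] (g a) where
  size_bdd := hB.mono fun a => hle a _ le_rfl
  exists_prog i j := by
    set wa := width A α with hwa
    set wb := width A β with hwb
    set N := i + wa + j with hN
    obtain ⟨p, T, hT, hp⟩ := hn.exists_prog i j
    obtain ⟨q, U, hU, hq⟩ := hg.exists_prog i (j + 1 + wa)
    obtain ⟨r, V, ⟨P, hP⟩, hr⟩ := hh.exists_prog (N + 1) 0
    -- the time for the body of the loop
    set W : α → ℕ := fun a => P.eval (size A a + B a) +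
      (wb * (4 * (B a + B a) + 4 * (wb + wb)) + 1) with hW
    have hWp : PolyBdd A W := ((PolyBdd.size.add hB).eval P).add
      (((PolyBdd.const _).mul (((PolyBdd.const _).mul (hB.add hB)).add (.const _))).add (.const _))
    have hloop : ∀ (L : List (List (A ⊕ Bool))) (a : α), L.length = N → ∀ k ≤ n a,
        Runs (loop N fun _ => seq r (removeBlock (N + 1 + wa) wb wb))
          (mem (L ++ List.replicate k (Sum.inr true) :: (enc a ++ enc ((h a)^[n a - k] (g a)))))
          (mem (L ++ [] :: (enc a ++ enc ((h a)^[n a] (g a))))) (k * (W a + 1) + 1) := by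
      intro L a hL k
      induction k with
      | zero =>
        intro _
        exact (Runs.loop_nil _ (by rw [← hL, mem_get]; rfl)).mono (by omega)
      | succ k ih =>
        intro hk
        set b := (h a)^[n a - (k + 1)] (g a) with hb
        have hhb : h a b = (h a)^[n a - k] (g a) := by
          rw [hb, ← Function.iterate_succ_apply' (h a)]
          congr 2
          omega
        have hbB : size A b ≤ B a := hle a _ (Nat.sub_le _ _)
        have hbB' : size A (h a b) ≤ B a := by
          rw [hhb]; exact hle a _ (Nat.sub_le _ _)
        have h₁ := hr (L ++ [List.replicate k (Sum.inr true)]) [] (a, b) (by simp [hL]) rfl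
        have h₂ := runs_removeBlock (L ++ [List.replicate k (Sum.inr true)] ++ enc a)
          (enc (A := A) (h a b)) (enc (A := A) b)
        have hlen : (L ++ [List.replicate k (Sum.inr true)] ++ enc a).length = N + 1 + wa := by
          simp [hL, length_enc, hwa]; omega
        rw [hlen, length_enc, length_enc] at h₂
        simp only [enc, List.append_nil, List.append_assoc, List.singleton_append] at h₁ h₂
        have h₃ := ih (by omega)
        simp only [List.cons_append, List.append_assoc] at h₁ h₂
        rw [← hhb] at h₃
        have h₀ : mem (L ++ List.replicate (k + 1) (Sum.inr true) :: (enc a ++ enc b)) N =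
            Sum.inr true :: List.replicate k (Sum.inr true) := by
          rw [← hL, mem_get]; rfl
        refine (Runs.loop_cons (f := fun _ => seq r (removeBlock (N + 1 + wa) wb wb))
          h₀ (t := W a) ?_ h₃).mono (by rw [add_mul]; omega)
        rw [← hL, update_mem, hL]
        refine (h₁.seq h₂).mono ?_
        have hPa := (hP (a, b)).trans (P.eval_mono_nat (n := size A a + B a)
          (by rw [size_prod]; exact Nat.add_le_add_left hbB _))
        have e₁ : total (enc (A := A) b) ≤ B a := hbB
        have e₂ : total (enc (A := A) (h a b)) ≤ B a := hbB'
        exact add_le_add hPa (Nat.succ_le_succ (Nat.mul_le_mul_left _ (by omega)))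
    refine ⟨seq p (seq (copyBlock i (N + 1) wa) (seq q
      (seq (loop N fun _ => seq r (removeBlock (N + 1 + wa) wb wb))
        (removeBlock N wb (1 + wa))))),
      fun a => T a + ((5 * size A a + 2 * wa + 1) + (U a + ((n a * (W a + 1) + 1) +
        ((1 + wa) * (4 * (size A a + B a) + 4 * ((1 + wa) + wb)) + 1)))),
      hT.add (PolyBdd.add ((((PolyBdd.const _).mul .size).add (.const _)).add (.const _)) (hU.add
          (PolyBdd.add ?_ ?_))), ?_⟩
    · have := hn.size_bdd
      simp only [size_nat] at this
      exact (this.mul (hWp.add (.const _))).add (.const _)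
    · exact ((PolyBdd.const _).mul (((PolyBdd.const _).mul (PolyBdd.size.add hB)).add
        (.const _))).add (.const _)
    · intro l m a hl hm
      have hlen : (l ++ enc a ++ m).length = N := by simp [hl, hm, length_enc, hN, hwa]; omega
      have h₁ := hp l m a hl hm
      have h₂ := runs_copyBlock (enc (A := A) a) l (m ++ enc (n a))
      have h₃ := hq l (m ++ enc (n a) ++ enc a) a hl (by simp [hm, length_enc, hwa, enc]; omega)
      have h₄ := hloop (l ++ enc a ++ m) a hlen (n a) le_rfl
      have h₅ := runs_removeBlock (l ++ enc a ++ m) (enc (A := A) ((h a)^[n a] (g a)))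
        ([] :: enc (A := A) a)
      have hlen₂ : (l ++ enc a ++ (m ++ enc (A := A) (n a))).length = N + 1 := by
        rw [← List.append_assoc, List.length_append, hlen]; rfl
      rw [hlen₂, hl, length_enc] at h₂
      rw [hlen, length_enc, List.length_cons, length_enc, Nat.add_comm (width A α)] at h₅
      have hn' : enc (A := A) (n a) = [List.replicate (n a) (Sum.inr true)] := rfl
      rw [Nat.sub_self, Function.iterate_zero_apply] at h₄
      simp only [hn', List.append_assoc, List.cons_append, List.nil_append] at h₁ h₂ h₃ h₄ h₅ ⊢
      refine h₁.seq (h₂.seq (h₃.seq (h₄.seq (h₅.mono ?_))))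
      have e₂ : total (enc (A := A) ((h a)^[n a] (g a))) ≤ B a := hle a _ le_rfl
      rw [total_cons, List.length_nil, Nat.zero_add]
      gcongr
      exact le_rfl

/-- A function is computable in polynomial time if its argument and its value are each stored on
one stack, and a program transforms the stack on top of the memory accordingly. -/
theorem of_top {f : α → β} (e : α → List (A ⊕ Bool)) (y : List (A ⊕ Bool) → List (A ⊕ Bool))
    (he : ∀ a, enc a = [e a]) (hf : ∀ a, enc (f a) = [y (e a)]) (c d : ℕ)
    (hy : ∀ x, (y x).length ≤ c * x.length + d) (p : ℕ → StackProg (A ⊕ Bool))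
    (hp : ∀ (l : List (List (A ⊕ Bool))) (x : List (A ⊕ Bool)),
      Runs (p l.length) (mem (l ++ [x])) (mem (l ++ [y x])) (c * x.length + d)) :
    PolyTime A f := by
  have hsize : ∀ a, size A a = (e a).length := fun a => by simp [size, he]
  have hbdd : PolyBdd A fun a : α => c * (e a).length + d := by
    simp only [← hsize]
    exact ((PolyBdd.const _).mul .size).add (.const _)
  refine ⟨hbdd.mono fun a => ?_, fun i j => ?_⟩
  · simpa [size, hf] using hy (e a)
  · obtain ⟨q, T, hT, hq⟩ := (PolyTime.id (A := A) (α := α)).exists_prog i j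
    refine ⟨seq q (p (i + width A α + j)), _, hT.add hbdd, ?_⟩
    intro l m a hl hm
    have hlen : (l ++ enc a ++ m).length = i + width A α + j := by
        rw [List.length_append, List.length_append, length_enc, hl, hm]
    have h₁ := hq l m a hl hm
    have h₂ := hp (l ++ enc a ++ m) (e a)
    rw [hlen] at h₂
    rw [hf]
    exact h₁.seq (by simpa only [he] using h₂)

theorem succ' : PolyTime A Nat.succ :=
  of_top (fun n => List.replicate n (Sum.inr true)) (fun x => Sum.inr true :: x) (fun _ => rfl)
    (fun _ => rfl) 1 1 (by simp) (fun n => push n (Sum.inr true)) fun l x => by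
      have h := runs_push l.length (Sum.inr true) (mem (l ++ [x]))
      rw [mem_get, update_mem] at h
      exact h.mono (by omega)

theorem runs_pop {Γ : Type} (l : List (List Γ)) (x : List Γ) :
    Runs (popCases l.length fun _ => skip) (mem (l ++ [x])) (mem (l ++ [x.tail])) 2 := by
  refine Runs.popCases (t := 1) ?_
  rw [mem_get, update_mem]
  exact runs_skip _

theorem pred' : PolyTime A Nat.pred :=
  of_top (fun n => List.replicate n (Sum.inr true)) List.tail (fun _ => rfl)
    (fun n => by simp [enc]) 1 2 (fun x => by simp; omega)
    (fun n => popCases n fun _ => skip) fun l x => (runs_pop l x).mono (by omega)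

theorem tail' : PolyTime A (List.tail : List Bool → List Bool) :=
  of_top (fun l => l.map Sum.inr) List.tail (fun _ => rfl)
    (fun n => by simp [enc]) 1 2 (fun x => by simp; omega)
    (fun n => popCases n fun _ => skip) fun l x => (runs_pop l x).mono (by omega)

theorem cons' (b : Bool) : PolyTime A (List.cons b) :=
  of_top (fun l => l.map Sum.inr) (fun x => Sum.inr b :: x) (fun _ => rfl)
    (fun _ => rfl) 1 1 (by simp) (fun n => push n (Sum.inr b)) fun l x => by
      have h := runs_push l.length (Sum.inr b) (mem (l ++ [x]))
      rw [mem_get, update_mem] at h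
      exact h.mono (by omega)

open Classical in
/-- It can be tested in polynomial time whether the topmost symbol of a stack, if any, has a given
property. -/
theorem of_head (e : α → List (A ⊕ Bool)) (he : ∀ a, enc a = [e a]) (Q : Option (A ⊕ Bool) → Prop) :
    PolyTime A fun a => Q (e a).head? := by
  refine of_top e (fun x => if Q x.head? then [Sum.inr true] else []) he (fun _ => rfl) 2 3
    (fun x => by split_ifs <;> simp) (fun n => popCases n fun o =>
      seq (clear n) (if Q o then push n (Sum.inr true) else skip)) fun l x => ?_
  refine (Runs.popCases (t := (2 * x.tail.length + 1) + 1) ?_).mono ?_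
  rotate_left
  · simp only [List.length_tail]; omega
  rw [mem_get, update_mem]
  refine Runs.seq (s' := mem (l ++ [[]])) ?_ ?_
  · have h := runs_clear l.length _ _ (mem_get l x.tail [])
    rwa [update_mem] at h
  · split_ifs
    · have h := runs_push l.length (Sum.inr true) (mem (l ++ [[]]))
      rwa [mem_get, update_mem] at h
    · exact runs_skip _

theorem head' : PolyTime A fun l : List Bool => l.head? = some true := by
  have h := of_head (A := A) (α := List Bool) (fun l => l.map Sum.inr) (fun _ => rfl)
    (fun o => o = some (Sum.inr true))
  simpa using h

theorem ne_zero' : PolyTime A fun n : ℕ => n ≠ 0 := by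
  have h := of_head (A := A) (α := ℕ) (fun n => List.replicate n (Sum.inr true)) (fun _ => rfl)
    (fun o => o ≠ none)
  simpa using h

/-- A map is applied to the symbols of a stack by moving them to another stack and back, which
restores their order. -/
theorem runs_map {Γ : Type} (g : Γ → Γ) (l : List (List Γ)) (x : List Γ) :
    Runs (seq (moveMap g l.length (l.length + 1)) (moveMap _root_.id (l.length + 1) l.length))
      (mem (l ++ [x])) (mem (l ++ [x.map g])) (4 * x.length + 2) := by
  have h₁ := runs_moveMap g (j := l.length + 1) (by simp) _ _ (mem_get l x [])
  have hlen : (l ++ [[]] : List (List Γ)).length = l.length + 1 := by simp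
  have h0 : mem (l ++ [x]) (l.length + 1) = [] := by simp [mem]
  rw [update_mem, ← hlen, update_mem_length, hlen, h0, List.append_nil] at h₁
  have h₂ := runs_moveMap _root_.id (i := l.length + 1) (j := l.length) (by simp)
    (x.map g).reverse (mem (l ++ [[]] ++ [(x.map g).reverse])) (by simp [mem])
  rw [← hlen, update_mem, mem_append_nil, hlen, update_mem] at h₂
  have : mem (l ++ [[]] ++ [(x.map g).reverse]) l.length = [] := by simp [mem]
  rw [this] at h₂
  simp only [List.map_id, List.reverse_reverse, List.append_nil] at h₂
  exact (h₁.seq h₂).mono (by simp; omega)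

/-- The marks of the positions with a given kind of letter. -/
theorem map' (P : A → Bool) : PolyTime A (List.map P) :=
  of_top (fun w => w.map Sum.inl) (List.map (Sum.elim (fun a => Sum.inr (P a)) Sum.inr))
    (fun _ => rfl) (fun w => by simp [enc]) 4 2 (fun x => by simp; omega)
    (fun n => seq (moveMap _ n (n + 1)) (moveMap _root_.id (n + 1) n)) fun l x => runs_map _ l x

theorem length' : PolyTime A (List.length : List A → ℕ) :=
  of_top (fun w => w.map Sum.inl) (List.map fun _ => Sum.inr true)
    (fun _ => rfl) (fun w => by simp [enc, Function.comp_def]) 4 2 (fun x => by simp; omega)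
    (fun n => seq (moveMap _ n (n + 1)) (moveMap _root_.id (n + 1) n)) fun l x => runs_map _ l x

end PolyTime

/-- A language is in P if membership in it is computable in polynomial time. -/
theorem inP_of_polyTime {A : Type} [Finite A] (L : Language A) (h : PolyTime A fun w => w ∈ L) :
    InP L := by
  obtain ⟨p, T, ⟨P, hP⟩, hp⟩ := h.exists_prog 1 0
  refine inP_of_run L (seq (moveMap id 0 1) (seq p (clear 1)))
    (2 * Polynomial.X + 1 + (P + (2 * Polynomial.X + 1))) fun w => ?_
  have hsize : size A w = w.length := by simp [size, enc]
  set x := (w.map Sum.inl : List (A ⊕ Bool))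
  have h0 : Function.update (fun _ => []) 0 x.reverse = mem ([] ++ [x.reverse]) := by
    rw [← update_mem_length]
    rfl
  set y : List (A ⊕ Bool) := @ite _ (w ∈ L) (Classical.propDecidable _) [Sum.inr true] [] with hy
  have h₁ := runs_moveMap id (i := 0) (j := 1) (by simp) _ _ (mem_get [] x.reverse [])
  have e₁ : Function.update (Function.update (mem ([] ++ [x.reverse])) 0 []) 1
      ((x.reverse.map id).reverse ++ mem ([] ++ [x.reverse]) 1) = mem [[], x] := by
    funext k
    rcases k with _ | _ | k <;> simp [mem]
  have h₂ : Runs p (mem [[], x]) (mem [[], x, y]) (T w) := hp [[]] [] w rfl rfl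
  have h₃ := runs_clear 1 _ (mem [[], x, y]) rfl
  have e₂ : Function.update (mem [[], x, y]) 1 [] = Function.update (fun _ => []) 2 y := by
    funext k
    rcases k with _ | _ | _ | k <;> simp [mem]
  rw [e₁] at h₁
  rw [e₂] at h₃
  obtain ⟨t, ht, hr⟩ := h₁.seq (h₂.seq h₃)
  refine ⟨y, t, ?_, ?_, ?_, ?_⟩
  · have := hP w
    rw [hsize] at this
    simp only [List.length_reverse, x, List.length_map, mem, List.getD_cons_succ,
      List.getD_cons_zero] at ht
    simp
    omega
  · rw [hy]; split_ifs <;> rfl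
  · rw [hy]; split_ifs with hw <;> simp [hw]
  · rw [h0]
    exact hr

open StackEnc StackProg

/-! ### Arithmetic, bounded search and tables in polynomial time -/

open Classical in
/-- The least `y < n` with `P y`, if there is one, and else `n`. It is defined by iteration, so
that it is easily seen to be computable in polynomial time. -/
noncomputable def search (P : ℕ → Prop) (n : ℕ) : ℕ :=
  (fun y => if P y then y else y + 1)^[n] 0

open Classical in
theorem search_spec (P : ℕ → Prop) (n : ℕ) :
    search P n ≤ n ∧ (∀ i < search P n, ¬ P i) ∧ (search P n < n → P (search P n)) := by
  induction n with
  | zero => simp [search]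
  | succ n ih =>
    obtain ⟨h₁, h₂, h₃⟩ := ih
    have h : search P (n + 1) = if P (search P n) then search P n else search P n + 1 :=
      Function.iterate_succ_apply' _ _ _
    rw [h]
    split_ifs with hP
    · exact ⟨by omega, h₂, fun _ => hP⟩
    · have : search P n = n := by
        by_contra hne
        exact hP (h₃ (by omega))
      refine ⟨by omega, fun i hi => ?_, fun hlt => by omega⟩
      rcases Nat.lt_succ_iff_lt_or_eq.1 hi with hi | rfl
      · exact h₂ i hi
      · exact hP

theorem search_lt_iff {P : ℕ → Prop} {n : ℕ} : search P n < n ↔ ∃ i < n, P i := by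
  obtain ⟨h₁, h₂, h₃⟩ := search_spec P n
  refine ⟨fun h => ⟨_, h, h₃ h⟩, fun ⟨i, hi, hP⟩ => ?_⟩
  by_contra h
  exact h₂ i (by omega) hP

/-- If `i` is the only number below `n` with the property `P`, then the search finds it. -/
theorem search_eq {P : ℕ → Prop} {n i : ℕ} (hi : i < n) (h : ∀ j < n, P j ↔ j = i) :
    search P n = i := by
  have hlt : search P n < n := search_lt_iff.2 ⟨i, hi, (h i hi).2 rfl⟩
  exact (h _ hlt).1 ((search_spec P n).2.2 hlt)

namespace PolyTime

variable {A α β : Type} [StackEnc A α] [StackEnc A β] {f g : α → ℕ} {P Q : α → Prop}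

theorem congr {f g : α → β} (hf : PolyTime A f) (h : ∀ a, f a = g a) : PolyTime A g :=
  funext h ▸ hf

@[fun_prop]
theorem succ (hf : PolyTime A f) : PolyTime A fun a => (f a).succ :=
  succ'.comp hf

@[fun_prop]
theorem pred (hf : PolyTime A f) : PolyTime A fun a => (f a).pred :=
  pred'.comp hf

@[fun_prop]
theorem add (hf : PolyTime A f) (hg : PolyTime A g) : PolyTime A fun a => f a + g a := by
  have hs := hf.size_bdd.add hg.size_bdd
  simp only [size_nat] at hs
  have := iterate (h := fun _ y => Nat.succ y) hg hf (by fun_prop) hs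
    (fun a i hi => by simpa using hi)
  simpa using this

@[fun_prop]
theorem sub (hf : PolyTime A f) (hg : PolyTime A g) : PolyTime A fun a => f a - g a := by
  have hs := hf.size_bdd
  simp only [size_nat] at hs
  have := iterate (h := fun _ y => Nat.pred y) hg hf (by fun_prop) hs
    (fun a i hi => by
      rw [size_nat]
      exact (Nat.pred_iterate _ _).trans_le (Nat.sub_le _ _))
  exact this.congr fun a => Nat.pred_iterate _ _

@[fun_prop]
theorem mul (hf : PolyTime A f) (hg : PolyTime A g) : PolyTime A fun a => f a * g a := by
  have key : ∀ m i : ℕ, (fun y => y + m)^[i] 0 = m * i := by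
    intro m i
    induction i with
    | zero => rfl
    | succ i ih => rw [Function.iterate_succ_apply', ih, Nat.mul_succ]
  have hs := hf.size_bdd.mul hg.size_bdd
  simp only [size_nat] at hs
  have := iterate (h := fun a y => y + f a) hg (const 0) (by fun_prop) hs
    (fun a i hi => by rw [key, size_nat]; exact Nat.mul_le_mul_left _ hi)
  simpa only [key] using this

@[fun_prop]
theorem ne_zero (hf : PolyTime A f) : PolyTime A fun a => f a ≠ 0 :=
  ne_zero'.comp hf

@[fun_prop]
theorem lt (hf : PolyTime A f) (hg : PolyTime A g) : PolyTime A fun a => f a < g a := by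
  have h : PolyTime A fun a => g a - f a ≠ 0 := by fun_prop
  simpa only [Nat.sub_ne_zero_iff_lt] using h

open Classical in
@[fun_prop]
theorem not (hP : PolyTime A P) : PolyTime A fun a => ¬ P a := by
  have h : PolyTime A fun a => if P a then False else True := by fun_prop
  simpa using h

open Classical in
@[fun_prop]
theorem and (hP : PolyTime A P) (hQ : PolyTime A Q) : PolyTime A fun a => P a ∧ Q a := by
  have h : PolyTime A fun a => if P a then Q a else False := by fun_prop
  simpa using h

@[fun_prop]
theorem or (hP : PolyTime A P) (hQ : PolyTime A Q) : PolyTime A fun a => P a ∨ Q a := by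
  have h : PolyTime A fun a => ¬ (¬ P a ∧ ¬ Q a) := by fun_prop
  simpa only [not_and_or, not_not] using h

theorem imp (hP : PolyTime A P) (hQ : PolyTime A Q) : PolyTime A fun a => P a → Q a := by
  have h : PolyTime A fun a => ¬ P a ∨ Q a := by fun_prop
  simpa only [imp_iff_not_or] using h

@[fun_prop]
theorem le (hf : PolyTime A f) (hg : PolyTime A g) : PolyTime A fun a => f a ≤ g a := by
  have h : PolyTime A fun a => ¬ g a < f a := by fun_prop
  simpa only [not_lt] using h

@[fun_prop]
theorem eq (hf : PolyTime A f) (hg : PolyTime A g) : PolyTime A fun a => f a = g a := by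
  have h : PolyTime A fun a => f a ≤ g a ∧ g a ≤ f a := by fun_prop
  simpa only [le_antisymm_iff] using h

open Classical in
theorem search {R : α → ℕ → Prop} (hf : PolyTime A f)
    (hR : PolyTime A fun x : α × ℕ => R x.1 x.2) :
    PolyTime A fun a => search (R a) (f a) := by
  have hs := hf.size_bdd
  simp only [size_nat] at hs
  refine iterate (h := fun a y => if R a y then y else y + 1) hf (const 0) (by fun_prop) hs ?_
  intro a i hi
  rw [size_nat]
  exact (search_spec (R a) i).1.trans hi

theorem exists_lt {R : α → ℕ → Prop} (hf : PolyTime A f)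
    (hR : PolyTime A fun x : α × ℕ => R x.1 x.2) : PolyTime A fun a => ∃ i < f a, R a i := by
  have h := (hf.search hR).lt hf
  simpa only [search_lt_iff] using h

theorem forall_lt {R : α → ℕ → Prop} (hf : PolyTime A f)
    (hR : PolyTime A fun x : α × ℕ => R x.1 x.2) : PolyTime A fun a => ∀ i < f a, R a i := by
  have h := (hf.exists_lt (R := fun a i => ¬ R a i) (by fun_prop)).not
  simpa using h

theorem exists_finite {ι : Type} [Finite ι] {R : α → ι → Prop}
    (hR : ∀ i, PolyTime A fun a => R a i) : PolyTime A fun a => ∃ i, R a i := by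
  have key : ∀ s : List ι, PolyTime A fun a => ∃ i ∈ s, R a i := by
    intro s
    induction s with
    | nil => simpa using const (α := α) False
    | cons i s ih => simpa using (hR i).or ih
  obtain ⟨_⟩ := nonempty_fintype ι
  simpa using key Finset.univ.toList

theorem forall_finite {ι : Type} [Finite ι] {R : α → ι → Prop}
    (hR : ∀ i, PolyTime A fun a => R a i) : PolyTime A fun a => ∀ i, R a i := by
  have h := (exists_finite (R := fun a i => ¬ R a i) fun i => (hR i).not).not
  simpa using h

@[fun_prop]
theorem div (hf : PolyTime A f) (hg : PolyTime A g) : PolyTime A fun a => f a / g a := by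
  have h := (hf.add (const 1)).search (R := fun a q => g a = 0 ∧ q = 0 ∨ f a < (q + 1) * g a ∧
    q * g a ≤ f a) (by fun_prop)
  refine h.congr fun a => ?_
  refine search_eq (Nat.lt_succ_of_le (Nat.div_le_self _ _)) fun q _ => ?_
  rcases Nat.eq_zero_or_pos (g a) with h0 | h0
  · simp [h0]
  · rw [eq_comm (b := f a / g a), Nat.div_eq_iff h0]
    have : g a ≠ 0 := h0.ne'
    have : (q + 1) * g a = q * g a + g a := by ring
    constructor <;> intro h <;> omega

@[fun_prop]
theorem mod (hf : PolyTime A f) (hg : PolyTime A g) : PolyTime A fun a => f a % g a := by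
  have h : PolyTime A fun a => f a - g a * (f a / g a) := by fun_prop
  refine h.congr fun a => ?_
  have := Nat.mod_add_div (f a) (g a)
  omega

@[fun_prop]
theorem pow (hf : PolyTime A f) (k : ℕ) : PolyTime A fun a => f a ^ k := by
  induction k with
  | zero => simpa using const 1
  | succ k ih => simpa only [pow_succ] using ih.mul hf

@[fun_prop]
theorem length {l : α → List A} (hl : PolyTime A l) : PolyTime A fun a => (l a).length :=
  length'.comp hl

theorem getElem?_eq_true {l : α → List Bool} (hl : PolyTime A l) (hf : PolyTime A f) :
    PolyTime A fun a => (l a)[f a]? = some true := by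
  have key : ∀ (l : List Bool) (i : ℕ), List.tail^[i] l = l.drop i := by
    intro l i
    induction i with
    | zero => rfl
    | succ i ih => rw [Function.iterate_succ_apply', ih, List.tail_drop]
  have h := iterate (h := fun _ => List.tail) hf hl (tail'.comp (by fun_prop)) hl.size_bdd
    (fun a i _ => by rw [key]; simp)
  simpa only [key, List.head?_drop] using head'.comp h

open Classical in
@[fun_prop]
theorem getElem?_eq {l : α → List A} (hl : PolyTime A l) (hf : PolyTime A f) (c : A) :
    PolyTime A fun a => (l a)[f a]? = some c := by
  have h := getElem?_eq_true ((map' fun d => decide (d = c)).comp hl) hf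
  simpa using h

open Classical in
/-- The table of the values of a predicate can be computed in polynomial time. -/
theorem map_range {R : α → ℕ → Prop} (hf : PolyTime A f)
    (hR : PolyTime A fun x : α × ℕ => R x.1 x.2) :
    PolyTime A fun a => (List.range (f a)).map fun i => decide (R a i) := by
  have key : ∀ a, ∀ i ≤ f a, (fun y : ℕ × List Bool => (y.1 - 1, decide (R a (y.1 - 1)) :: y.2))^[i]
      (f a, []) = (f a - i, (List.range' (f a - i) i).map fun i => decide (R a i)) := by
    intro a i
    induction i with
    | zero => intro _; rfl
    | succ i ih =>
      intro hi
      rw [Function.iterate_succ_apply', ih (by omega)]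
      have h : f a - i - 1 = f a - (i + 1) := by omega
      have h' : f a - (i + 1) + 1 = f a - i := by omega
      simp only [h, List.range'_succ, h', List.map_cons]
  have hcons : PolyTime A fun x : α × ℕ × List Bool => decide (R x.1 (x.2.1 - 1)) :: x.2.2 := by
    have h1 := (cons' (A := A) true).comp (f := List.cons true)
      (g := fun x : α × ℕ × List Bool => x.2.2) (by fun_prop)
    have h2 := (cons' (A := A) false).comp (f := List.cons false)
      (g := fun x : α × ℕ × List Bool => x.2.2) (by fun_prop)
    have h3 : PolyTime A fun x : α × ℕ × List Bool => R x.1 (x.2.1 - 1) :=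
      hR.comp (g := fun x : α × ℕ × List Bool => (x.1, x.2.1 - 1)) (by fun_prop)
    refine (h3.ite h1 h2).congr fun x => ?_
    split_ifs with h <;> simp [h]
  have hs := hf.size_bdd.add hf.size_bdd
  simp only [size_nat] at hs
  have h := iterate (n := f) (g := fun a => (f a, ([] : List Bool)))
    (h := fun a y => (y.1 - 1, decide (R a (y.1 - 1)) :: y.2)) hf (by fun_prop) (by fun_prop) hs
    (fun a i hi => by rw [key a i hi]; simp; omega)
  refine (snd h).congr fun a => ?_
  rw [key a _ le_rfl]
  simp [List.range_eq_range']

end PolyTime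

/-! ### Ancestors in tree patterns -/

namespace TreePattern

open Relation

variable {S M N : Type} {p : TreePattern S M} {t : TreePattern S N}

theorem not_transGen_self (p : TreePattern S M) (a : M) : ¬ TransGen p.Edge a a :=
  p.acyclic a

theorem wellFounded_edge (p : TreePattern S M) : WellFounded p.Edge := by
  have := p.finite
  have : Std.Irrefl (TransGen p.Edge) := ⟨p.not_transGen_self⟩
  exact Subrelation.wf (fun h => TransGen.single h)
    (Finite.wellFounded_of_trans_of_irrefl (TransGen p.Edge))

theorem root_ancestor (p : TreePattern S M) (b : M) : p.Ancestor p.root b := by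
  induction b using p.wellFounded_edge.induction with
  | _ b ih =>
    by_cases h : b = p.root
    · subst h
      exact .refl
    · obtain ⟨a, ha, -⟩ := p.existsUnique_pred b h
      exact (ih a ha).tail ha

theorem not_edge_ancestor {a b : M} (h : p.Edge a b) : ¬ p.Ancestor b a := fun h' =>
  p.not_transGen_self a (TransGen.head' h h')

theorem not_edge_root (p : TreePattern S M) (a : M) : ¬ p.Edge a p.root := fun h =>
  not_edge_ancestor h (p.root_ancestor a)

theorem edge_unique {a a' b : M} (h : p.Edge a b) (h' : p.Edge a' b) : a = a' :=
  (p.existsUnique_pred b fun hb => p.not_edge_root a (hb ▸ h)).unique h h'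

theorem transGen_edge_iff {a b : M} : TransGen p.Edge a b ↔ p.Ancestor a b ∧ a ≠ b := by
  constructor
  · intro h
    exact ⟨h.to_reflTransGen, fun hab => p.not_transGen_self a (hab ▸ h)⟩
  · rintro ⟨h, hab⟩
    exact (reflTransGen_iff_eq_or_transGen.1 h).resolve_left hab.symm

/-- The ancestors of a node form a chain. -/
theorem ancestor_total {a b c : M} (h : p.Ancestor a c) (h' : p.Ancestor b c) :
    p.Ancestor a b ∨ p.Ancestor b a := by
  induction h with
  | refl => exact .inr h'
  | @tail c d hac hcd ih =>
    rcases ReflTransGen.cases_tail h' with h | ⟨e, he, hed⟩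
    · subst h
      exact .inl (hac.tail hcd)
    · exact ih (edge_unique hed hcd ▸ he)

theorem eq_of_siblings {u c c' : M} (h : p.Edge u c) (h' : p.Edge u c') (hc : p.Ancestor c c') :
    c = c' := by
  rcases ReflTransGen.cases_tail hc with hc | ⟨e, he, hec⟩
  · exact hc.symm
  · exact absurd (edge_unique hec h' ▸ he) (not_edge_ancestor h)

/-- The subtrees of different children of a node are disjoint. -/
theorem eq_of_common_descendant {u c c' x : M} (h : p.Edge u c) (h' : p.Edge u c')
    (hc : p.Ancestor c x) (hc' : p.Ancestor c' x) : c = c' := by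
  rcases ancestor_total hc hc' with h₁ | h₁
  · exact eq_of_siblings h h' h₁
  · exact (eq_of_siblings h' h h₁).symm

/-- A map that sends each node to its parent, and the root to itself, describes the ancestors. -/
theorem ancestor_iff_iterate {f : M → M} (hf : ∀ a b, p.Edge a b → f b = a)
    (hr : f p.root = p.root) {a b : M} :
    p.Ancestor a b ↔ ∃ j ≤ Nat.card M, f^[j] b = a := by
  have := p.finite
  constructor
  · suffices ∀ b, p.Ancestor a b → ∃ j ≤ {x | p.Ancestor x b}.ncard, f^[j] b = a by
      intro h
      obtain ⟨j, hj, hja⟩ := this b h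
      exact ⟨j, hj.trans (Set.ncard_le_card _), hja⟩
    intro b h
    induction h with
    | refl => exact ⟨0, Nat.zero_le _, rfl⟩
    | @tail b c hab hbc ih =>
      obtain ⟨j, hj, hja⟩ := ih
      refine ⟨j + 1, Nat.succ_le_of_lt (hj.trans_lt (Set.ncard_lt_ncard ?_)), ?_⟩
      · refine ⟨fun x hx => ReflTransGen.tail hx hbc, fun h => ?_⟩
        exact not_edge_ancestor hbc (h (ReflTransGen.refl : p.Ancestor c c))
      · rw [Function.iterate_succ_apply, hf b c hbc, hja]
  · rintro ⟨j, -, rfl⟩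
    induction j with
    | zero => exact .refl
    | succ j ih =>
      rw [Function.iterate_succ_apply']
      refine ReflTransGen.trans ?_ ih
      generalize f^[j] b = c
      by_cases hc : c = p.root
      · rw [hc, hr]
      · obtain ⟨d, hd, -⟩ := p.existsUnique_pred c hc
        rw [hf d c hd]
        exact .single hd

/-! ### Embeddings of subtrees -/

theorem IsTree.edge_eq (ht : t.IsTree) : t.Edge = t.child := by
  funext a b
  simp [Edge, ht.1 a b]

/-- There is an ancestor-preserving embedding of the subpattern of `p` at the node `u` that sends
`u` to `v`. -/
def SubEmbeds (t : TreePattern S N) (p : TreePattern S M) (u : M) (v : N) : Prop :=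
  ∃ h : M → N, h u = v ∧
    (∀ a b, p.Ancestor u a → p.child a b → t.Edge (h a) (h b)) ∧
    (∀ a b, p.Ancestor u a → p.desc a b → TransGen t.Edge (h a) (h b)) ∧
    (∀ a, p.Ancestor u a → p.lab a ≠ none → t.lab (h a) = p.lab a) ∧
    ∀ a b, p.Ancestor u a → p.Ancestor u b → (t.Ancestor (h a) (h b) ↔ p.Ancestor a b)

theorem ancEmbeds_iff_subEmbeds (ht : t.IsTree) :
    AncEmbeds t p ↔ SubEmbeds t p p.root t.root := by
  have hr := p.root_ancestor
  unfold AncEmbeds SubEmbeds Ancestor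
  rw [ht.edge_eq]
  constructor
  · rintro ⟨h, ⟨h₁, h₂, h₃, h₄⟩, h₅⟩
    exact ⟨h, h₁, fun a b _ => h₂ a b, fun a b _ => h₃ a b, fun a _ => h₄ a, fun a b _ _ => h₅ a b⟩
  · rintro ⟨h, h₁, h₂, h₃, h₄, h₅⟩
    exact ⟨h, ⟨h₁, fun a b => h₂ a b (hr a), fun a b => h₃ a b (hr a), fun a => h₄ a (hr a)⟩,
      fun a b => h₅ a b (hr a) (hr b)⟩

/-- The subpattern at `u` embeds at `v` if and only if the labels fit, and the subpatterns at the
children of `u` embed at pairwise incomparable descendants of `v`. This is what makes dynamic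
programming possible: the embeddings of the subpatterns at different children do not interact
otherwise. -/
theorem subEmbeds_iff {u : M} {v : N} :
    SubEmbeds t p u v ↔ (p.lab u ≠ none → t.lab v = p.lab u) ∧ ∃ g : M → N,
      (∀ c, p.Edge u c → SubEmbeds t p c (g c) ∧ (p.child u c → t.Edge v (g c)) ∧
        (p.desc u c → t.Ancestor v (g c) ∧ v ≠ g c)) ∧
      ∀ c c', p.Edge u c → p.Edge u c' → c ≠ c' → ¬ t.Ancestor (g c) (g c') := by
  constructor
  · rintro ⟨h, rfl, h₂, h₃, h₄, h₅⟩
    refine ⟨h₄ u .refl, h, fun c hc => ⟨⟨h, rfl, ?_, ?_, ?_, ?_⟩, h₂ u c .refl,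
      fun hd => transGen_edge_iff.1 (h₃ u c .refl hd)⟩, ?_⟩
    · exact fun a b ha => h₂ a b (ha.head hc)
    · exact fun a b ha => h₃ a b (ha.head hc)
    · exact fun a ha => h₄ a (ha.head hc)
    · exact fun a b ha hb => h₅ a b (ha.head hc) (hb.head hc)
    · intro c c' hc hc' hne h
      exact hne (eq_of_siblings hc hc' ((h₅ c c' (.single hc) (.single hc')).1 h))
  · classical
    rintro ⟨hlab, g, hg, hinc⟩
    have hH : ∀ c, ∃ h : M → N, p.Edge u c → h c = g c ∧
        (∀ a b, p.Ancestor c a → p.child a b → t.Edge (h a) (h b)) ∧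
        (∀ a b, p.Ancestor c a → p.desc a b → TransGen t.Edge (h a) (h b)) ∧
        (∀ a, p.Ancestor c a → p.lab a ≠ none → t.lab (h a) = p.lab a) ∧
        ∀ a b, p.Ancestor c a → p.Ancestor c b →
          (t.Ancestor (h a) (h b) ↔ p.Ancestor a b) := by
      intro c
      by_cases hc : p.Edge u c
      · obtain ⟨h, hh⟩ := (hg c hc).1
        exact ⟨h, fun _ => hh⟩
      · exact ⟨g, fun h => absurd h hc⟩
    choose H hH using hH
    -- the child of `u` below which a proper descendant of `u` lies
    have hbr : ∀ x, ∃ c, p.Ancestor u x → x ≠ u → p.Edge u c ∧ p.Ancestor c x := by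
      intro x
      by_cases hx : p.Ancestor u x ∧ x ≠ u
      · rcases ReflTransGen.cases_head hx.1 with h | ⟨c, hc, h⟩
        · exact absurd h.symm hx.2
        · exact ⟨c, fun _ _ => ⟨hc, h⟩⟩
      · exact ⟨x, fun h h' => absurd ⟨h, h'⟩ hx⟩
    choose br hbr using hbr
    set h : M → N := fun x => if x = u then v else H (br x) x with hh
    have hu : h u = v := by simp [hh]
    have hne : ∀ c x, p.Edge u c → p.Ancestor c x → x ≠ u := by
      rintro c x hc hx rfl
      exact not_edge_ancestor hc hx
    have hx : ∀ c x, p.Edge u c → p.Ancestor c x → h x = H c x := by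
      intro c x hc hcx
      have h₁ := hne c x hc hcx
      obtain ⟨h₂, h₃⟩ := hbr x (hcx.head hc) h₁
      simp only [hh, if_neg h₁, eq_of_common_descendant h₂ hc h₃ hcx]
    have hcases : ∀ x, p.Ancestor u x → x = u ∨ ∃ c, p.Edge u c ∧ p.Ancestor c x := by
      intro x hx
      by_cases hxu : x = u
      · exact .inl hxu
      · exact .inr ⟨_, hbr x hx hxu⟩
    -- every proper descendant of `u` goes to a proper descendant of `v`
    have hv : ∀ c, p.Edge u c → TransGen t.Edge v (g c) := by
      rintro c (hc | hc)
      · exact .single ((hg c (.inl hc)).2.1 hc)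
      · exact transGen_edge_iff.2 ((hg c (.inr hc)).2.2 hc)
    have hgc : ∀ c x, p.Edge u c → p.Ancestor c x → t.Ancestor (g c) (H c x) := by
      intro c x hc hcx
      obtain ⟨h₁, -, -, -, h₅⟩ := hH c hc
      rw [← h₁]
      exact (h₅ c x .refl hcx).2 hcx
    refine ⟨h, hu, ?_, ?_, ?_, ?_⟩
    · intro a b ha hab
      rcases hcases a ha with rfl | ⟨c, hc, hca⟩
      · rw [hu, hx b b (.inl hab) .refl, (hH b (.inl hab)).1]
        exact (hg b (.inl hab)).2.1 hab
      · rw [hx c a hc hca, hx c b hc (hca.tail (.inl hab))]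
        exact (hH c hc).2.1 a b hca hab
    · intro a b ha hab
      rcases hcases a ha with rfl | ⟨c, hc, hca⟩
      · rw [hu, hx b b (.inr hab) .refl, (hH b (.inr hab)).1]
        exact hv b (.inr hab)
      · rw [hx c a hc hca, hx c b hc (hca.tail (.inr hab))]
        exact (hH c hc).2.2.1 a b hca hab
    · intro a ha
      rcases hcases a ha with rfl | ⟨c, hc, hca⟩
      · rw [hu]
        exact hlab
      · rw [hx c a hc hca]
        exact (hH c hc).2.2.2.1 a hca
    · intro a b ha hb
      rcases hcases a ha with rfl | ⟨c, hc, hca⟩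
      · refine iff_of_true ?_ hb
        rw [hu]
        rcases hcases b hb with rfl | ⟨c, hc, hcb⟩
        · rw [hu]
          exact .refl
        · rw [hx c b hc hcb]
          exact (hv c hc).to_reflTransGen.trans (hgc c b hc hcb)
      · rcases hcases b hb with rfl | ⟨c', hc', hcb⟩
        · refine iff_of_false ?_ fun hab => not_edge_ancestor hc (hca.trans hab)
          rw [hu, hx c a hc hca]
          intro hav
          exact t.not_transGen_self v ((hv c hc).trans_left ((hgc c a hc hca).trans hav))
        · rw [hx c a hc hca, hx c' b hc' hcb]
          by_cases hcc : c = c'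
          · subst hcc
            exact (hH c hc).2.2.2.2 a b hca hcb
          · refine iff_of_false ?_ fun hab =>
              hcc (eq_of_common_descendant hc hc' (hca.trans hab) hcb)
            intro hab
            rcases ancestor_total ((hgc c a hc hca).trans hab) (hgc c' b hc' hcb) with h₁ | h₁
            · exact hinc c c' hc hc' hcc h₁
            · exact hinc c' c hc' hc (Ne.symm hcc) h₁

/-- A node has at most `k` children if and only if they can be listed with `k` entries. -/
theorem degree_le_iff (p : TreePattern S M) (k : ℕ) (u : M) :
    p.degree u ≤ k ↔ ∃ f : Fin k → M, ∀ c, p.Edge u c → ∃ i, f i = c := by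
  have := p.finite
  constructor
  · intro h
    have hfin := Set.toFinite {b | p.Edge u b}
    rw [degree, Set.ncard_eq_toFinset_card _ hfin] at h
    refine ⟨fun i => if hi : i.1 < hfin.toFinset.card then hfin.toFinset.equivFin.symm ⟨i, hi⟩
      else p.root, fun c hc => ?_⟩
    have hc' : c ∈ hfin.toFinset := hfin.mem_toFinset.2 hc
    set j := hfin.toFinset.equivFin ⟨c, hc'⟩ with hj
    exact ⟨⟨j, j.2.trans_le h⟩, by simp [hj]⟩
  · rintro ⟨f, hf⟩
    calc p.degree u ≤ (Set.range f).ncard := Set.ncard_le_ncard (fun c hc => hf c hc)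
      _ ≤ k := by
        rw [← Set.image_univ]
        refine (Set.ncard_image_le).trans ?_
        simp

end TreePattern

/-! ### Words that represent tree patterns -/

theorem List.getElem?_flatMap_of_length {ι B : Type} (f : ι → List B) {k : ℕ}
    (hf : ∀ a, (f a).length = k) {j : ℕ} (hj : j < k) :
    ∀ (l : List ι) (i : ℕ), (l.flatMap f)[i * k + j]? = l[i]?.bind fun a => (f a)[j]?
  | [], i => by simp
  | a :: l, 0 => by
    rw [List.flatMap_cons, List.getElem?_append_left (by rw [hf]; omega)]
    simp
  | a :: l, i + 1 => by
    have h : (i + 1) * k + j - k = i * k + j := by rw [Nat.succ_mul]; omega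
    rw [List.flatMap_cons, List.getElem?_append_right (by rw [hf, Nat.succ_mul]; omega), hf, h,
      List.getElem?_flatMap_of_length f hf hj l i]
    simp

namespace TreePattern

open Relation

variable {S : Type} {n : ℕ} {w : List (Letter S)} {o : ℕ} {p : TreePattern S (Fin n)}

/-- The word `w` contains the word for the pattern `p` from the position `o` on. -/
structure Represents (w : List (Letter S)) (o : ℕ) (p : TreePattern S (Fin n)) : Prop where
  node : ∀ a : Fin n, w[o + a * (n + 1)]? = some (.node (decide (a = p.root)) (p.lab a))
  entry : ∀ a b : Fin n, w[o + a * (n + 1) + 1 + b]? = some (p.entry a b)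

theorem length_encode (p : TreePattern S (Fin n)) : p.encode.length = n * (n + 1) := by
  simp [encode, List.length_flatMap]

theorem getElem?_encode_node (p : TreePattern S (Fin n)) (a : Fin n) :
    p.encode[a * (n + 1)]? = some (.node (decide (a = p.root)) (p.lab a)) := by
  have h := List.getElem?_flatMap_of_length (fun a =>
    Letter.node (decide (a = p.root)) (p.lab a) :: (List.finRange n).map (p.entry a))
    (k := n + 1) (by simp) (Nat.succ_pos n) (List.finRange n) a
  rw [Nat.add_zero] at h
  rw [encode, h]
  simp

theorem getElem?_encode_entry (p : TreePattern S (Fin n)) (a b : Fin n) :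
    p.encode[a * (n + 1) + 1 + b]? = some (p.entry a b) := by
  have h := List.getElem?_flatMap_of_length (fun a =>
    Letter.node (decide (a = p.root)) (p.lab a) :: (List.finRange n).map (p.entry a))
    (k := n + 1) (by simp) (j := 1 + b) (by omega) (List.finRange n) a
  rw [encode, Nat.add_assoc, h, Nat.add_comm 1]
  simp

theorem represents_iff :
    Represents w o p ↔ ∀ i < n * (n + 1), w[o + i]? = p.encode[i]? := by
  have hlt : ∀ a : Fin n, ∀ j < n + 1, a * (n + 1) + j < n * (n + 1) := by
    intro a j hj
    have : (a.1 + 1) * (n + 1) ≤ n * (n + 1) := Nat.mul_le_mul_right _ a.2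
    rw [Nat.succ_mul] at this
    omega
  constructor
  · intro h i hi
    have ha : i / (n + 1) < n := Nat.div_lt_of_lt_mul (by rwa [Nat.mul_comm])
    have hj : i % (n + 1) < n + 1 := Nat.mod_lt i (Nat.succ_pos n)
    have hdiv := Nat.div_add_mod' i (n + 1)
    rcases Nat.eq_zero_or_pos (i % (n + 1)) with h0 | h0
    · have hi' : i = i / (n + 1) * (n + 1) := by omega
      have h₁ := h.node ⟨_, ha⟩
      rw [← p.getElem?_encode_node ⟨_, ha⟩] at h₁
      simpa only [← hi'] using h₁
    · have hb : i % (n + 1) - 1 < n := by omega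
      have hi' : i = i / (n + 1) * (n + 1) + 1 + (i % (n + 1) - 1) := by omega
      have h₁ := h.entry ⟨_, ha⟩ ⟨_, hb⟩
      rw [← p.getElem?_encode_entry ⟨_, ha⟩ ⟨_, hb⟩, Nat.add_assoc, Nat.add_assoc,
        ← Nat.add_assoc _ 1] at h₁
      simpa only [← hi'] using h₁
  · refine fun h => ⟨fun a => ?_, fun a b => ?_⟩
    · rw [h _ (by simp), p.getElem?_encode_node]
    · rw [← p.getElem?_encode_entry, ← h _ (by rw [Nat.add_assoc]; exact hlt a _ (by omega)),
        Nat.add_assoc, Nat.add_assoc, Nat.add_assoc]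

/-- A word is the word for a pair if it has the right length and contains the separator and the
words for the two components at the right places. -/
theorem eq_encodePair_iff {m : ℕ} {t : TreePattern S (Fin n)} {p : TreePattern S (Fin m)} :
    w = encodePair t p ↔ w.length = n * (n + 1) + 1 + m * (m + 1) ∧
      w[n * (n + 1)]? = some .separator ∧ Represents w 0 t ∧
      Represents w (n * (n + 1) + 1) p := by
  have hlen : (encodePair t p).length = n * (n + 1) + 1 + m * (m + 1) := by
    simp [encodePair, length_encode]; omega
  have h₁ : ∀ i < n * (n + 1), (encodePair t p)[i]? = t.encode[i]? := fun i hi =>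
    List.getElem?_append_left (by rwa [length_encode])
  have h₂ : (encodePair t p)[n * (n + 1)]? = some .separator := by
    rw [encodePair, List.getElem?_append_right (by rw [length_encode]), length_encode]
    simp
  have h₃ : ∀ i, (encodePair t p)[n * (n + 1) + 1 + i]? = p.encode[i]? := by
    intro i
    rw [encodePair, List.getElem?_append_right (by rw [length_encode]; omega), length_encode]
    have : n * (n + 1) + 1 + i - n * (n + 1) = i + 1 := by omega
    rw [this, List.getElem?_cons_succ]
  rw [represents_iff, represents_iff]
  simp only [Nat.zero_add]
  constructor
  · rintro rfl
    exact ⟨hlen, h₂, h₁, fun i _ => h₃ i⟩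
  · rintro ⟨hl, hs, ht, hp⟩
    refine List.ext_getElem? fun i => ?_
    rcases lt_trichotomy i (n * (n + 1)) with h | rfl | h
    · rw [ht i h, h₁ i h]
    · rw [hs, h₂]
    · obtain ⟨j, rfl⟩ : ∃ j, i = n * (n + 1) + 1 + j := ⟨i - (n * (n + 1) + 1), by omega⟩
      rw [h₃]
      by_cases hj : j < m * (m + 1)
      · exact hp j hj
      · rw [List.getElem?_eq_none (by omega), List.getElem?_eq_none (by rw [length_encode]; omega)]

/-- The word `w`, read as a pattern with `n` nodes from the position `o` on, has a child edge from
`a` to `b`. -/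
def ChildAt (w : List (Letter S)) (o n a b : ℕ) : Prop :=
  w[o + a * (n + 1) + 1 + b]? = some .childEdge

/-- The word `w`, read as a pattern, has a descendant edge from `a` to `b`. -/
def DescAt (w : List (Letter S)) (o n a b : ℕ) : Prop :=
  w[o + a * (n + 1) + 1 + b]? = some .descEdge

/-- The word `w`, read as a pattern, has an edge from `a` to `b`. -/
def EdgeAt (w : List (Letter S)) (o n a b : ℕ) : Prop :=
  ChildAt w o n a b ∨ DescAt w o n a b

/-- The word `w`, read as a pattern, has the label `x` at the node `a`. -/
def LabelAt (w : List (Letter S)) (o n a : ℕ) (x : Option S) : Prop :=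
  ∃ r : Bool, w[o + a * (n + 1)]? = some (.node r x)

/-- The word `w`, read as a pattern, marks the node `a` as a root. -/
def RootAt (w : List (Letter S)) (o n a : ℕ) : Prop :=
  ∃ x : Option S, w[o + a * (n + 1)]? = some (.node true x)

open Classical in
/-- The first node that has `b` as a child, or else `b` itself. -/
noncomputable def parentAt (w : List (Letter S)) (o n b : ℕ) : ℕ :=
  if search (fun a => EdgeAt w o n a b) n < n then search (fun a => EdgeAt w o n a b) n else b

/-- The node `a` can be reached from `b` by going to the parent at most `n` times. -/
def AncestorAt (w : List (Letter S)) (o n a b : ℕ) : Prop :=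
  ∃ j < n + 1, (parentAt w o n)^[j] b = a

/-- The word `w` contains the word for some tree pattern with `n` nodes from the position `o`
on. -/
def WellFormedAt (w : List (Letter S)) (o n : ℕ) : Prop :=
  (∀ a < n, (∃ x, LabelAt w o n a x) ∧ ∀ b < n, EdgeAt w o n a b ∨
    w[o + a * (n + 1) + 1 + b]? = some .noEdge) ∧
  ∃ r < n, RootAt w o n r ∧ (∀ a < n, (RootAt w o n a → a = r) ∧ ¬ EdgeAt w o n a r) ∧
    ∀ b < n, AncestorAt w o n r b ∧ (b = r ∨ ∃ a < n, EdgeAt w o n a b ∧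
      ∀ a' < n, EdgeAt w o n a' b → a' = a)

namespace Represents

theorem childAt_iff (h : Represents w o p) (a b : Fin n) :
    ChildAt w o n a b ↔ p.child a b := by
  rw [ChildAt, h.entry, TreePattern.entry]
  split_ifs <;> simp_all

theorem descAt_iff (h : Represents w o p) (a b : Fin n) :
    DescAt w o n a b ↔ p.desc a b := by
  have := p.disjoint a b
  rw [DescAt, h.entry, TreePattern.entry]
  split_ifs <;> simp_all

theorem edgeAt_iff (h : Represents w o p) (a b : Fin n) :
    EdgeAt w o n a b ↔ p.Edge a b := by
  rw [EdgeAt, h.childAt_iff, h.descAt_iff, Edge]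

theorem labelAt_iff (h : Represents w o p) (a : Fin n) (x : Option S) :
    LabelAt w o n a x ↔ p.lab a = x := by
  simp [LabelAt, h.node]

theorem rootAt_iff (h : Represents w o p) (a : Fin n) :
    RootAt w o n a ↔ a = p.root := by
  simp [RootAt, h.node]

theorem parentAt_eq (h : Represents w o p) {a b : Fin n} (hab : p.Edge a b) :
    parentAt w o n b = a := by
  have : search (fun a => EdgeAt w o n a b) n = a := by
    refine search_eq a.2 fun j hj => ?_
    rw [h.edgeAt_iff ⟨j, hj⟩ b]
    constructor
    · intro hjb
      rw [edge_unique hab hjb]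
    · rintro rfl
      exact hab
  rw [parentAt, this, if_pos a.2]

theorem parentAt_root (h : Represents w o p) : parentAt w o n p.root = p.root := by
  rw [parentAt, if_neg]
  rw [search_lt_iff]
  rintro ⟨a, ha, hab⟩
  exact p.not_edge_root _ ((h.edgeAt_iff ⟨a, ha⟩ p.root).1 hab)

theorem ancestorAt_iff (h : Represents w o p) (a b : Fin n) :
    AncestorAt w o n a b ↔ p.Ancestor a b := by
  have hlt : ∀ b : Fin n, parentAt w o n b < n := by
    intro b
    rw [parentAt]
    split_ifs with h
    · exact h
    · exact b.2
  set f : Fin n → Fin n := fun b => ⟨parentAt w o n b, hlt b⟩ with hf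
  have hiter : ∀ j, (parentAt w o n)^[j] b = f^[j] b := by
    intro j
    induction j with
    | zero => rfl
    | succ j ih => rw [Function.iterate_succ_apply', ih, Function.iterate_succ_apply']
  rw [ancestor_iff_iterate (f := f) (fun a b hab => Fin.ext (h.parentAt_eq hab))
    (Fin.ext h.parentAt_root)]
  simp only [AncestorAt, hiter, Nat.lt_succ_iff, Nat.card_eq_fintype_card, Fintype.card_fin,
    Fin.val_inj]

theorem wellFormedAt (h : Represents w o p) : WellFormedAt w o n := by
  refine ⟨fun a ha => ⟨⟨_, (h.labelAt_iff ⟨a, ha⟩ _).2 rfl⟩, fun b hb => ?_⟩,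
    p.root, p.root.2, (h.rootAt_iff _).2 rfl, fun a ha => ⟨fun hr => ?_, fun he => ?_⟩,
    fun b hb => ⟨?_, ?_⟩⟩
  · have h₁ := h.entry ⟨a, ha⟩ ⟨b, hb⟩
    rw [TreePattern.entry] at h₁
    split_ifs at h₁
    · exact .inl (.inl h₁)
    · exact .inl (.inr h₁)
    · exact .inr h₁
  · exact congrArg Fin.val ((h.rootAt_iff ⟨a, ha⟩).1 hr)
  · exact p.not_edge_root _ ((h.edgeAt_iff ⟨a, ha⟩ p.root).1 he)
  · exact (h.ancestorAt_iff p.root ⟨b, hb⟩).2 (p.root_ancestor _)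
  · by_cases hbr : (⟨b, hb⟩ : Fin n) = p.root
    · exact .inl (congrArg Fin.val hbr)
    · obtain ⟨a, ha, -⟩ := p.existsUnique_pred _ hbr
      refine .inr ⟨a, a.2, (h.edgeAt_iff a ⟨b, hb⟩).2 ha, fun a' ha' he => ?_⟩
      rw [edge_unique ha ((h.edgeAt_iff ⟨a', ha'⟩ ⟨b, hb⟩).1 he)]

end Represents

theorem wellFormedAt_iff :
    WellFormedAt w o n ↔ ∃ p : TreePattern S (Fin n), Represents w o p := by
  classical
  refine ⟨?_, fun ⟨p, hp⟩ => hp.wellFormedAt⟩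
  rintro ⟨h₁, r, hr, hroot, h₂, h₃⟩
  choose lab hlab using fun a : Fin n => (h₁ a a.2).1
  -- the depth of a node is the number of steps to the root, and it increases along edges
  have hdepth : ∀ b : Fin n, ∃ j, (parentAt w o n)^[j] b = r := fun b =>
    let ⟨j, _, hj⟩ := (h₃ b b.2).1
    ⟨j, hj⟩
  have hpar : ∀ a b : Fin n, EdgeAt w o n a b → parentAt w o n b = a := by
    intro a b hab
    have hbr : b.1 ≠ r := fun hb => (h₂ a a.2).2 (hb ▸ hab)
    obtain ⟨c, hc, hcb, huniq⟩ := (h₃ b b.2).2.resolve_left hbr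
    have : search (fun a => EdgeAt w o n a b) n = a := by
      refine search_eq a.2 fun j hj => ⟨fun hjb => ?_, ?_⟩
      · rw [huniq j hj hjb, huniq a a.2 hab]
      · rintro rfl
        exact hab
    rw [parentAt, this, if_pos a.2]
  have hlt : ∀ a b : Fin n, EdgeAt w o n a b → Nat.find (hdepth a) < Nat.find (hdepth b) := by
    intro a b hab
    have hbr : b.1 ≠ r := fun hb => (h₂ a a.2).2 (hb ▸ hab)
    have hb := Nat.find_spec (hdepth b)
    rcases hj : Nat.find (hdepth b) with _ | j
    · rw [hj] at hb
      exact absurd hb hbr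
    · rw [hj, Function.iterate_succ_apply, hpar a b hab] at hb
      exact Nat.lt_succ_of_le (Nat.find_min' _ hb)
  refine ⟨{ finite := inferInstance, root := ⟨r, hr⟩, lab := lab,
            child := fun a b => ChildAt w o n a b, desc := fun a b => DescAt w o n a b,
            disjoint := ?_, acyclic := ?_, existsUnique_pred := ?_ }, ?_, ?_⟩
  · rintro a b ⟨hc, hd⟩
    have := hc.symm.trans hd
    simp at this
  · intro a ha
    have : ∀ b, TransGen (fun x y : Fin n => EdgeAt w o n x y) a b →
        Nat.find (hdepth a) < Nat.find (hdepth b) := by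
      intro b hb
      induction hb with
      | single h => exact hlt _ _ h
      | tail _ h ih => exact ih.trans (hlt _ _ h)
    exact lt_irrefl _ (this a ha)
  · intro b hb
    obtain ⟨a, ha, hab, huniq⟩ := (h₃ b b.2).2.resolve_left fun h => hb (Fin.ext h)
    exact ⟨⟨a, ha⟩, hab, fun a' ha' => Fin.ext (huniq a' a'.2 ha')⟩
  · intro a
    obtain ⟨s, hs⟩ := hlab a
    rw [hs]
    congr 2
    cases s
    · refine (decide_eq_false fun har => ?_).symm
      obtain ⟨x, hx⟩ := hroot
      rw [har, hx] at hs
      simp at hs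
    · exact (decide_eq_true (Fin.ext ((h₂ a a.2).1 ⟨_, hs⟩))).symm
  · intro a b
    rw [TreePattern.entry]
    split_ifs with hc hd
    · exact hc
    · exact hd
    · exact ((h₁ a a.2).2 b b.2).resolve_left fun h => h.elim hc hd

end TreePattern

/-! ### The algorithm -/

namespace TreePattern

open Relation StackEnc

variable {S : Type} {n m : ℕ} {w : List (Letter S)}

/-- The `i`-th digit of `c` in base `b`. The digits of a single number encode a tuple. -/
def digit (b c i : ℕ) : ℕ :=
  c / b ^ i % b

theorem exists_digit_eq {b k : ℕ} (f : Fin k → Fin b) :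
    ∃ c < b ^ k, ∀ i : Fin k, digit b c i = f i := by
  refine ⟨finFunctionFinEquiv f, (finFunctionFinEquiv f).2, fun i => ?_⟩
  conv_rhs => rw [← finFunctionFinEquiv.symm_apply_apply f]
  rfl

/-- The nodes of the pattern in `w` have at most `k` children: these are the digits of a number. -/
def DegreeLeAt (k : ℕ) (w : List (Letter S)) (o m : ℕ) : Prop :=
  ∀ u < m, ∃ C < m ^ k, ∀ c < m, EdgeAt w o m u c → ∃ i : Fin k, digit m C i = c

/-- One step of the dynamic program. The word `w` represents a tree with `n` nodes and a pattern
with `m` nodes, and the entry `c * n + d` of the table `T` says whether the subpattern at `c` is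
known to embed at `d`. Here `C` encodes a list of `k` nodes of the pattern that contains the
children of `u`, and `V` encodes the list of their images. -/
def EmbedStep (k : ℕ) (w : List (Letter S)) (n m : ℕ) (T : List Bool) (u v : ℕ) : Prop :=
  (LabelAt w (n * (n + 1) + 1) m u none ∨
    ∃ x, LabelAt w (n * (n + 1) + 1) m u x ∧ LabelAt w 0 n v x) ∧
  ∃ C < m ^ k, ∃ V < n ^ k,
    (∀ c < m, EdgeAt w (n * (n + 1) + 1) m u c → ∃ i : Fin k, digit m C i = c ∧
      T[c * n + digit n V i]? = some true ∧
      (ChildAt w (n * (n + 1) + 1) m u c → EdgeAt w 0 n v (digit n V i)) ∧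
      (DescAt w (n * (n + 1) + 1) m u c →
        AncestorAt w 0 n v (digit n V i) ∧ v ≠ digit n V i)) ∧
    ∀ i j : Fin k, EdgeAt w (n * (n + 1) + 1) m u (digit m C i) →
      EdgeAt w (n * (n + 1) + 1) m u (digit m C j) → digit m C i ≠ digit m C j →
      ¬ AncestorAt w 0 n (digit n V i) (digit n V j)

open Classical in
/-- The table after `j` steps of the dynamic program. -/
noncomputable def embedTable (k : ℕ) (w : List (Letter S)) (n m j : ℕ) : List Bool :=
  (fun T => (List.range (m * n)).map fun x => decide (EmbedStep k w n m T (x / n) (x % n)))^[j] []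

/-- The conditions that the algorithm checks. -/
def Accepts (k : ℕ) (w : List (Letter S)) : Prop :=
  ∃ n < w.length + 1, ∃ m < w.length + 1,
    w.length = n * (n + 1) + 1 + m * (m + 1) ∧ w[n * (n + 1)]? = some .separator ∧
    WellFormedAt w 0 n ∧ WellFormedAt w (n * (n + 1) + 1) m ∧
    (∀ a < n, ¬ LabelAt w 0 n a none ∧ ∀ b < n, ¬ DescAt w 0 n a b) ∧
    DegreeLeAt k w (n * (n + 1) + 1) m ∧
    ∃ u < m, RootAt w (n * (n + 1) + 1) m u ∧ ∃ v < n, RootAt w 0 n v ∧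
      (embedTable k w n m m)[u * n + v]? = some true

section Correctness

variable {k : ℕ} {o : ℕ} {t : TreePattern S (Fin n)} {p : TreePattern S (Fin m)}

theorem degreeLeAt_iff (hp : Represents w o p) :
    DegreeLeAt k w o m ↔ ∀ u, p.degree u ≤ k := by
  have hm : 0 < m := p.root.pos
  have h : ∀ u : Fin m, (∃ C < m ^ k, ∀ c < m, EdgeAt w o m u c → ∃ i : Fin k, digit m C i = c) ↔
      p.degree u ≤ k := by
    intro u
    rw [degree_le_iff]
    constructor
    · rintro ⟨C, -, hC⟩
      refine ⟨fun i => ⟨digit m C i, Nat.mod_lt _ hm⟩, fun c hc => ?_⟩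
      obtain ⟨i, hi⟩ := hC c c.2 ((hp.edgeAt_iff u c).2 hc)
      exact ⟨i, Fin.ext hi⟩
    · rintro ⟨f, hf⟩
      obtain ⟨C, hC, hCf⟩ := exists_digit_eq f
      refine ⟨C, hC, fun c hcm hc => ?_⟩
      obtain ⟨i, hi⟩ := hf ⟨c, hcm⟩ ((hp.edgeAt_iff u ⟨c, hcm⟩).1 hc)
      exact ⟨i, by rw [hCf, hi]⟩
  exact ⟨fun hd u => (h u).1 (hd u u.2), fun hd u hu => (h ⟨u, hu⟩).2 (hd _)⟩

theorem embedStep_iff (ht : Represents w 0 t) (hp : Represents w (n * (n + 1) + 1) p)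
    (T : List Bool) {u : Fin m} (hk : p.degree u ≤ k) (v : Fin n)
    (hT : ∀ c, p.Edge u c → ∀ d : Fin n, T[c * n + d]? = some true ↔ SubEmbeds t p c d) :
    EmbedStep k w n m T u v ↔ SubEmbeds t p u v := by
  have hn : 0 < n := v.pos
  have hm : 0 < m := u.pos
  rw [subEmbeds_iff, EmbedStep]
  refine and_congr ?_ ?_
  · simp only [hp.labelAt_iff, ht.labelAt_iff]
    constructor
    · rintro (h | ⟨x, h, h'⟩) hne
      · exact absurd h hne
      · rw [h, h']
    · intro h
      by_cases h' : p.lab u = none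
      · exact .inl h'
      · exact .inr ⟨_, rfl, h h'⟩
  · constructor
    · rintro ⟨C, -, V, -, h₁, h₂⟩
      have h₁' : ∀ c : Fin m, ∃ d : Fin n, p.Edge u c → ∃ i : Fin k, digit m C i = c ∧
          digit n V i = d ∧ SubEmbeds t p c d ∧ (p.child u c → t.Edge v d) ∧
          (p.desc u c → t.Ancestor v d ∧ v ≠ d) := by
        intro c
        by_cases hc : p.Edge u c
        · obtain ⟨i, hi, hi₁, hi₂, hi₃⟩ := h₁ c c.2 ((hp.edgeAt_iff u c).2 hc)
          refine ⟨⟨digit n V i, Nat.mod_lt _ hn⟩, fun _ => ⟨i, hi, rfl, (hT c hc _).1 hi₁,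
            fun h => ?_, fun h => ?_⟩⟩
          · exact (ht.edgeAt_iff v ⟨digit n V i, Nat.mod_lt _ hn⟩).1
              (hi₂ ((hp.childAt_iff u c).2 h))
          · obtain ⟨h₃, h₄⟩ := hi₃ ((hp.descAt_iff u c).2 h)
            exact ⟨(ht.ancestorAt_iff v ⟨digit n V i, Nat.mod_lt _ hn⟩).1 h₃,
              fun h => h₄ (congrArg Fin.val h)⟩
        · exact ⟨v, fun h => absurd h hc⟩
      choose g hg using h₁'
      refine ⟨g, fun c hc => ?_, fun c c' hc hc' hne h => ?_⟩
      · obtain ⟨i, -, -, h⟩ := hg c hc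
        exact h
      · obtain ⟨i, hi, hi', -⟩ := hg c hc
        obtain ⟨j, hj, hj', -⟩ := hg c' hc'
        have := h₂ i j
        rw [hi, hj, hi', hj', hp.edgeAt_iff, hp.edgeAt_iff, ht.ancestorAt_iff, Ne,
          Fin.val_inj] at this
        exact this hc hc' hne h
    · rintro ⟨g, hg, hinc⟩
      obtain ⟨f, hf⟩ := (degree_le_iff p k u).1 hk
      obtain ⟨C, hC, hCf⟩ := exists_digit_eq f
      obtain ⟨V, hV, hVg⟩ := exists_digit_eq (g ∘ f)
      refine ⟨C, hC, V, hV, fun c hcm hc => ?_, fun i j hi hj hij => ?_⟩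
      · have hc' := (hp.edgeAt_iff u ⟨c, hcm⟩).1 hc
        obtain ⟨i, hi⟩ := hf _ hc'
        obtain ⟨h₁, h₂, h₃⟩ := hg _ hc'
        have hVi : digit n V i = g ⟨c, hcm⟩ := by rw [hVg, Function.comp_apply, hi]
        refine ⟨i, by rw [hCf, hi], ?_, fun h => ?_, fun h => ?_⟩
        · rw [hVi]
          exact (hT _ hc' _).2 h₁
        · rw [hVi, ht.edgeAt_iff]
          exact h₂ ((hp.childAt_iff u ⟨c, hcm⟩).1 h)
        · rw [hVi, ht.ancestorAt_iff, Ne, Fin.val_inj]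
          exact h₃ ((hp.descAt_iff u ⟨c, hcm⟩).1 h)
      · rw [hCf, hp.edgeAt_iff] at hi hj
        rw [hVg, hVg, ht.ancestorAt_iff]
        refine hinc _ _ hi hj fun h => hij ?_
        rw [hCf, hCf, h]

open Classical in
/-- After `j` steps, the table is correct for the subpatterns with at most `j` nodes. -/
theorem getElem?_embedTable (ht : Represents w 0 t) (hp : Represents w (n * (n + 1) + 1) p)
    (hk : ∀ u, p.degree u ≤ k) (j : ℕ) : ∀ (u : Fin m) (v : Fin n),
      {x | p.Ancestor u x}.ncard ≤ j →
      ((embedTable k w n m j)[u * n + v]? = some true ↔ SubEmbeds t p u v) := by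
  induction j with
  | zero =>
    intro u v hu
    have h0 : {x | p.Ancestor u x} = ∅ := (Set.ncard_eq_zero (Set.toFinite _)).1 (by omega)
    exact absurd (show u ∈ {x | p.Ancestor u x} from ReflTransGen.refl) (by simp [h0])
  | succ j ih =>
    intro u v hu
    have hlt : u * n + v < m * n := by
      have : (u.1 + 1) * n ≤ m * n := Nat.mul_le_mul_right _ u.2
      rw [Nat.succ_mul] at this
      omega
    have hdiv : (u * n + v) / n = u := by
      rw [Nat.mul_comm, Nat.mul_add_div v.pos, Nat.div_eq_of_lt v.2, Nat.add_zero]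
    have hmod : (u * n + v) % n = v := by
      rw [Nat.mul_comm, Nat.mul_add_mod, Nat.mod_eq_of_lt v.2]
    rw [embedTable, Function.iterate_succ_apply', ← embedTable, List.getElem?_map,
      List.getElem?_range hlt, Option.map_some, Option.some_inj, decide_eq_true_iff, hdiv, hmod]
    refine embedStep_iff ht hp _ (hk u) v fun c hc d => ih c d ?_
    have : {x | p.Ancestor c x}.ncard < {x | p.Ancestor u x}.ncard :=
      Set.ncard_lt_ncard ⟨fun x hx => ReflTransGen.head hc hx, fun h =>
        not_edge_ancestor hc (h (ReflTransGen.refl : p.Ancestor u u))⟩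
    omega

theorem mem_ancLanguage_iff : w ∈ ancLanguage S k ↔ Accepts k w := by
  constructor
  · rintro ⟨n, m, t, p, htree, hemb, hk, hw⟩
    obtain ⟨hlen, hsep, ht, hp⟩ := eq_encodePair_iff.1 hw
    have hn : n ≤ n * (n + 1) := Nat.le_mul_of_pos_right _ (Nat.succ_pos n)
    have hm : m ≤ m * (m + 1) := Nat.le_mul_of_pos_right _ (Nat.succ_pos m)
    refine ⟨n, by omega, m, by omega, hlen, hsep, ht.wellFormedAt, hp.wellFormedAt,
      fun a ha => ⟨fun h => ?_, fun b hb h => ?_⟩, (degreeLeAt_iff hp).2 hk,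
      p.root, p.root.2, (hp.rootAt_iff _).2 rfl, t.root, t.root.2, (ht.rootAt_iff _).2 rfl, ?_⟩
    · exact htree.2 _ ((ht.labelAt_iff ⟨a, ha⟩ _).1 h)
    · exact htree.1 _ _ ((ht.descAt_iff ⟨a, ha⟩ ⟨b, hb⟩).1 h)
    · refine (getElem?_embedTable ht hp hk m _ _ ?_).2 ((ancEmbeds_iff_subEmbeds htree).1 hemb)
      simpa using Set.ncard_le_card {x | p.Ancestor p.root x}
  · rintro ⟨n, -, m, -, hlen, hsep, ht, hp, htree, hk, u, hu, hur, v, hv, hvr, hT⟩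
    obtain ⟨t, ht⟩ := wellFormedAt_iff.1 ht
    obtain ⟨p, hp⟩ := wellFormedAt_iff.1 hp
    have htree' : t.IsTree :=
      ⟨fun a b h => (htree a a.2).2 b b.2 ((ht.descAt_iff a b).2 h),
        fun a h => (htree a a.2).1 ((ht.labelAt_iff a none).2 h)⟩
    have hk' := (degreeLeAt_iff hp).1 hk
    refine ⟨n, m, t, p, htree', ?_, hk', eq_encodePair_iff.2 ⟨hlen, hsep, ht, hp⟩⟩
    rw [ancEmbeds_iff_subEmbeds htree', ← (hp.rootAt_iff ⟨u, hu⟩).1 hur,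
      ← (ht.rootAt_iff ⟨v, hv⟩).1 hvr]
    refine (getElem?_embedTable ht hp hk' m ⟨u, hu⟩ ⟨v, hv⟩ ?_).1 hT
    simpa using Set.ncard_le_card {x | p.Ancestor ⟨u, hu⟩ x}

end Correctness

/-! ### The running time -/

instance [Finite S] : Finite (Letter S) := by
  refine Finite.of_surjective (Sum.elim (fun x : Bool × Option S => Letter.node x.1 x.2)
    (fun i : Fin 4 => ![.noEdge, .childEdge, .descEdge, .separator] i)) ?_
  rintro (⟨r, x⟩ | _ | _ | _ | _)
  exacts [⟨.inl (r, x), rfl⟩, ⟨.inr 0, rfl⟩, ⟨.inr 1, rfl⟩, ⟨.inr 2, rfl⟩, ⟨.inr 3, rfl⟩]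

section RunningTime

open PolyTime

variable {α : Type} [StackEnc (Letter S) α] {w : α → List (Letter S)} {o n m a b : α → ℕ}

@[fun_prop]
theorem polyTime_childAt (hw : PolyTime (Letter S) w) (ho : PolyTime (Letter S) o)
    (hn : PolyTime (Letter S) n) (ha : PolyTime (Letter S) a) (hb : PolyTime (Letter S) b) :
    PolyTime (Letter S) fun x => ChildAt (w x) (o x) (n x) (a x) (b x) := by
  unfold ChildAt
  fun_prop

@[fun_prop]
theorem polyTime_descAt (hw : PolyTime (Letter S) w) (ho : PolyTime (Letter S) o)
    (hn : PolyTime (Letter S) n) (ha : PolyTime (Letter S) a) (hb : PolyTime (Letter S) b) :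
    PolyTime (Letter S) fun x => DescAt (w x) (o x) (n x) (a x) (b x) := by
  unfold DescAt
  fun_prop

@[fun_prop]
theorem polyTime_edgeAt (hw : PolyTime (Letter S) w) (ho : PolyTime (Letter S) o)
    (hn : PolyTime (Letter S) n) (ha : PolyTime (Letter S) a) (hb : PolyTime (Letter S) b) :
    PolyTime (Letter S) fun x => EdgeAt (w x) (o x) (n x) (a x) (b x) := by
  unfold EdgeAt
  fun_prop

@[fun_prop]
theorem polyTime_labelAt (hw : PolyTime (Letter S) w) (ho : PolyTime (Letter S) o)
    (hn : PolyTime (Letter S) n) (ha : PolyTime (Letter S) a) (x : Option S) :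
    PolyTime (Letter S) fun y => LabelAt (w y) (o y) (n y) (a y) x :=
  exists_finite fun r => by fun_prop

@[fun_prop]
theorem polyTime_rootAt [Finite S] (hw : PolyTime (Letter S) w) (ho : PolyTime (Letter S) o)
    (hn : PolyTime (Letter S) n) (ha : PolyTime (Letter S) a) :
    PolyTime (Letter S) fun x => RootAt (w x) (o x) (n x) (a x) :=
  exists_finite fun r => by fun_prop

open Classical in
@[fun_prop]
theorem polyTime_parentAt (hw : PolyTime (Letter S) w) (ho : PolyTime (Letter S) o)
    (hn : PolyTime (Letter S) n) (hb : PolyTime (Letter S) b) :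
    PolyTime (Letter S) fun x => parentAt (w x) (o x) (n x) (b x) := by
  have h := hn.search (R := fun x a => EdgeAt (w x) (o x) (n x) a (b x)) (by fun_prop)
  unfold parentAt
  exact (h.lt hn).ite h hb

theorem parentAt_le (w : List (Letter S)) (o n b : ℕ) : parentAt w o n b ≤ max n b := by
  rw [parentAt]
  split_ifs with h
  · exact h.le.trans (le_max_left _ _)
  · exact le_max_right _ _

@[fun_prop]
theorem polyTime_ancestorAt (hw : PolyTime (Letter S) w) (ho : PolyTime (Letter S) o)
    (hn : PolyTime (Letter S) n) (ha : PolyTime (Letter S) a) (hb : PolyTime (Letter S) b) :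
    PolyTime (Letter S) fun x => AncestorAt (w x) (o x) (n x) (a x) (b x) := by
  have hB : PolyTime (Letter S) fun y : α × ℕ => n y.1 + b y.1 := by fun_prop
  have hs := hB.size_bdd
  simp only [size_nat] at hs
  have h := iterate (n := fun y : α × ℕ => y.2) (g := fun y => b y.1)
    (h := fun y c => parentAt (w y.1) (o y.1) (n y.1) c) (by fun_prop) (by fun_prop)
    (by fun_prop) hs fun y i _ => by
      rw [size_nat]
      suffices (parentAt (w y.1) (o y.1) (n y.1))^[i] (b y.1) ≤ max (n y.1) (b y.1) from
        this.trans (by omega)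
      induction i with
      | zero => exact le_max_right _ _
      | succ i ih =>
        rw [Function.iterate_succ_apply']
        have := parentAt_le (w y.1) (o y.1) (n y.1)
          ((parentAt (w y.1) (o y.1) (n y.1))^[i] (b y.1))
        omega
  exact (hn.add (const 1)).exists_lt (h.eq (by fun_prop))

theorem polyTime_wellFormedAt [Finite S] (hw : PolyTime (Letter S) w)
    (ho : PolyTime (Letter S) o) (hn : PolyTime (Letter S) n) :
    PolyTime (Letter S) fun x => WellFormedAt (w x) (o x) (n x) := by
  unfold WellFormedAt
  refine and (hn.forall_lt (and (exists_finite fun x => by fun_prop)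
    (forall_lt (by fun_prop) (by fun_prop)))) (hn.exists_lt (and (by fun_prop) (and
    (forall_lt (by fun_prop) (and (imp (by fun_prop) (by fun_prop)) (by fun_prop)))
    (forall_lt (by fun_prop) (and (by fun_prop) (or (by fun_prop) (exists_lt (by fun_prop)
      (and (by fun_prop) (forall_lt (by fun_prop) (imp (by fun_prop) (by fun_prop)))))))))))

@[fun_prop]
theorem polyTime_digit (ha : PolyTime (Letter S) a) (hb : PolyTime (Letter S) b) (i : ℕ) :
    PolyTime (Letter S) fun x => digit (a x) (b x) i := by
  unfold digit
  fun_prop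

theorem polyTime_degreeLeAt (k : ℕ) (hw : PolyTime (Letter S) w) (ho : PolyTime (Letter S) o)
    (hm : PolyTime (Letter S) m) :
    PolyTime (Letter S) fun x => DegreeLeAt k (w x) (o x) (m x) := by
  unfold DegreeLeAt
  exact hm.forall_lt (exists_lt (by fun_prop) (forall_lt (by fun_prop) (imp (by fun_prop)
    (exists_finite fun i => by fun_prop))))

theorem polyTime_embedStep [Finite S] (k : ℕ) {T : α → List Bool} (hw : PolyTime (Letter S) w)
    (hn : PolyTime (Letter S) n) (hm : PolyTime (Letter S) m) (hT : PolyTime (Letter S) T)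
    (ha : PolyTime (Letter S) a) (hb : PolyTime (Letter S) b) :
    PolyTime (Letter S) fun x => EmbedStep k (w x) (n x) (m x) (T x) (a x) (b x) := by
  unfold EmbedStep
  refine and (or (by fun_prop) (exists_finite fun x => by fun_prop)) (exists_lt (by fun_prop)
    (exists_lt (by fun_prop) (and (forall_lt (by fun_prop) (imp (by fun_prop)
      (exists_finite fun i => and (by fun_prop) (and (getElem?_eq_true (by fun_prop) (by fun_prop))
        (and (imp (by fun_prop) (by fun_prop)) (imp (by fun_prop) (by fun_prop)))))))
      (forall_finite fun i => forall_finite fun j => imp (by fun_prop) (imp (by fun_prop)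
        (imp (by fun_prop) (by fun_prop)))))))

open Classical in
theorem polyTime_embedTable [Finite S] (k : ℕ) (hw : PolyTime (Letter S) w)
    (hn : PolyTime (Letter S) n) (hm : PolyTime (Letter S) m) (ha : PolyTime (Letter S) a) :
    PolyTime (Letter S) fun x => embedTable k (w x) (n x) (m x) (a x) := by
  have hs := (hm.mul hn).size_bdd
  simp only [size_nat] at hs
  refine iterate ha (const []) (h := fun x T => (List.range (m x * n x)).map fun y =>
    decide (EmbedStep k (w x) (n x) (m x) T (y / n x) (y % n x))) ?_ hs fun x i _ => ?_
  · exact map_range (R := fun (x : α × List Bool) y => EmbedStep k (w x.1) (n x.1) (m x.1) x.2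
      (y / n x.1) (y % n x.1)) (by fun_prop) (polyTime_embedStep k (by fun_prop) (by fun_prop)
        (by fun_prop) (by fun_prop) (by fun_prop) (by fun_prop))
  · cases i with
    | zero => simp
    | succ i => rw [Function.iterate_succ_apply']; simp

theorem polyTime_accepts [Finite S] (k : ℕ) : PolyTime (Letter S) (Accepts (S := S) k) := by
  unfold Accepts
  refine exists_lt (by fun_prop) (exists_lt (by fun_prop) ?_)
  refine and (by fun_prop) (and (by fun_prop) (and
    (polyTime_wellFormedAt (by fun_prop) (by fun_prop) (by fun_prop)) (and
    (polyTime_wellFormedAt (by fun_prop) (by fun_prop) (by fun_prop)) (and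
    (forall_lt (by fun_prop) (and (by fun_prop) (forall_lt (by fun_prop) (by fun_prop)))) (and
    (polyTime_degreeLeAt k (by fun_prop) (by fun_prop) (by fun_prop))
    (exists_lt (by fun_prop) (and (by fun_prop) (exists_lt (by fun_prop) (and (by fun_prop)
      (getElem?_eq_true (polyTime_embedTable k (by fun_prop) (by fun_prop) (by fun_prop)
        (by fun_prop)) (by fun_prop)))))))))))

end RunningTime

end TreePattern

theorem theorem2 (S : Type) [Finite S] (k : ℕ) : InP (TreePattern.ancLanguage S k) := by
  refine inP_of_polyTime _ ?_
  simp only [TreePattern.mem_ancLanguage_iff]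
  exact TreePattern.polyTime_accepts k
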